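/- All $\mathrm{C}^*$-algebras are unital, $\otimes$ is the minimal (spatial) tensor product, and $A_1\star A_2$ is the (full) free product of unital $\mathrm{C}^*$-algebras with the units identified; $\iota_k\colon A_k\to A_1\star A_2$ ($k=1,2$) are the canonical inclusions. A compact quantum semigroup is a unital $\mathrm{C}^*$-algebra $A$ with a comultiplication, i.e. a unital $*$-homomorphism $\Delta_A\colon A\to A\otimes A$ which is coassociative: $(\Delta_A\otimes\mathrm{id})\circ\Delta_A=(\mathrm{id}\otimes\Delta_A)\circ\Delta_A$. A quantum semigroup morphism from $(A,\Delta_A)$ to $(B,\Delta_B)$ is a unital $*$-homomorphism $\Theta\colon A\to B$ with $(\Theta\otimes\Theta)\circ\Delta_A=\Delta_B\circ\Theta$. **Theorem.** Let $(A_1,\Delta_1)$ and $(A_2,\Delta_2)$ be compact quantum semigroups and let $C=A_1\star A_2$. Then there exists a unique coassociative unital $*$-homomorphism $\Delta_C\colon C\to C\otimes C$ such that $\iota_k$ is a quantum semigroup morphism from $(A_k,\Delta_k)$ to $(C,\Delta_C)$ for $k=1,2$. Moreover, for any compact quantum semigroup $(D,\Delta_D)$ and any quantum semigroup morphisms $\Theta_k\colon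 A_k\to D$ ($k=1,2$) there exists a unique $\Theta_C\colon C\to D$ such that $\Theta_k=\Theta_C\circ\iota_k$ ($k=1,2$) and $\Theta_C$ is a quantum semigroup morphism from $(C,\Delta_C)$ to $(D,\Delta_D)$. -/

import Mathlib

universe u

noncomputable section

open scoped TensorProduct InnerProductSpace

/-- A C⋆-seminorm on a complex ⋆-algebra `F`: a submultiplicative seminorm `p` with
`p (x⋆ x) = p x ^ 2`. -/
structure CStarSeminorm (F : Type*) [Ring F] [StarRing F] [Algebra ℂ F] extends
    Seminorm ℂ F where
  mul_le' : ∀ x y : F, toFun (x * y) ≤ toFun x * toFun y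
  star_mul_self' : ∀ x : F, toFun (star x * x) = toFun x ^ 2

namespace CStarSeminorm

section Completion

variable {F : Type*} [Ring F] [StarRing F] [Algebra ℂ F]

theorem star_le (p : CStarSeminorm F) (x : F) : p.toSeminorm (star x) ≤ p.toSeminorm x := by
  have h1 : p.toSeminorm (star (star x) * star x) = p.toSeminorm (star x) ^ 2 :=
    p.star_mul_self' (star x)
  have h2 : p.toSeminorm (star (star x) * star x)
      ≤ p.toSeminorm (star (star x)) * p.toSeminorm (star x) := p.mul_le' _ _
  rw [h1, star_star, sq] at h2
  rcases (apply_nonneg p.toSeminorm (star x)).eq_or_lt with h | h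
  · rw [← h]; exact apply_nonneg _ _
  · exact le_of_mul_le_mul_right h2 h

theorem star_eq (p : CStarSeminorm F) (x : F) : p.toSeminorm (star x) = p.toSeminorm x :=
  le_antisymm (p.star_le x) (by simpa using p.star_le (star x))

/-- The ⋆-algebra `F`, regarded as a seminormed algebra by means of `p`. -/
def Pre (_p : CStarSeminorm F) : Type _ := F

variable (p : CStarSeminorm F)

instance : Ring p.Pre := inferInstanceAs (Ring F)
instance : StarRing p.Pre := inferInstanceAs (StarRing F)
instance : Algebra ℂ p.Pre := inferInstanceAs (Algebra ℂ F)

/-- The identity map from `F` to the seminormed algebra `p.Pre`. -/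
def toPre : F ≃⋆ₐ[ℂ] p.Pre := (StarAlgEquiv.refl ℂ F : F ≃⋆ₐ[ℂ] F)

instance : SeminormedAddCommGroup p.Pre :=
  AddGroupSeminorm.toSeminormedAddCommGroup (E := p.Pre) p.toSeminorm.toAddGroupSeminorm

theorem norm_toPre (x : F) : ‖p.toPre x‖ = p.toSeminorm x := rfl

instance : SeminormedRing p.Pre :=
  { (inferInstance : SeminormedAddCommGroup p.Pre), (inferInstance : Ring p.Pre) with
    norm_mul_le := fun x y => p.mul_le' x y }

instance : NormedAlgebra ℂ p.Pre where
  __ := (inferInstance : Algebra ℂ p.Pre)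
  norm_smul_le r x := (p.toSeminorm.smul' r x).le

instance : NormedStarGroup p.Pre where
  norm_star_le x := p.star_le x

/-- The separation-completion of `F` with respect to the C⋆-seminorm `p`. -/
def Completion : Type _ := UniformSpace.Completion p.Pre

instance : NormedRing p.Completion := inferInstanceAs (NormedRing (UniformSpace.Completion p.Pre))
instance : CompleteSpace p.Completion :=
  inferInstanceAs (CompleteSpace (UniformSpace.Completion p.Pre))
instance : NormedSpace ℂ p.Completion :=
  inferInstanceAs (NormedSpace ℂ (UniformSpace.Completion p.Pre))

/-- The canonical map as a plain function. -/
def incl (x : F) : p.Completion := ((p.toPre x : p.Pre) : UniformSpace.Completion p.Pre)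

theorem denseRange_incl : DenseRange p.incl :=
  UniformSpace.Completion.denseRange_coe (α := p.Pre)

theorem norm_incl (x : F) : ‖p.incl x‖ = p.toSeminorm x :=
  UniformSpace.Completion.norm_coe (p.toPre x)

theorem incl_add (x y : F) : p.incl (x + y) = p.incl x + p.incl y :=
  UniformSpace.Completion.coe_add (p.toPre x) (p.toPre y)

theorem incl_mul (x y : F) : p.incl (x * y) = p.incl x * p.incl y :=
  UniformSpace.Completion.coe_mul (p.toPre x) (p.toPre y)

theorem incl_smul (c : ℂ) (x : F) : p.incl (c • x) = c • p.incl x :=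
  UniformSpace.Completion.coe_smul c (p.toPre x)

theorem incl_one : p.incl 1 = 1 := UniformSpace.Completion.coe_one p.Pre

theorem incl_zero : p.incl 0 = 0 := UniformSpace.Completion.coe_zero

theorem induction {P : p.Completion → Prop} (hc : IsClosed {z | P z})
    (h : ∀ x, P (p.incl x)) (z : p.Completion) : P z :=
  UniformSpace.Completion.induction_on (α := p.Pre) z hc h

theorem induction₂ {P : p.Completion → p.Completion → Prop}
    (hc : IsClosed {z : p.Completion × p.Completion | P z.1 z.2})
    (h : ∀ x y, P (p.incl x) (p.incl y)) (z w : p.Completion) : P z w :=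
  UniformSpace.Completion.induction_on₂ (α := p.Pre) (β := p.Pre) z w hc h

instance : NormedAlgebra ℂ p.Completion :=
  { Algebra.ofModule (R := ℂ) (A := p.Completion)
      (fun r => p.induction₂
        (isClosed_eq ((continuous_fst.const_smul r).mul continuous_snd)
          ((continuous_fst.mul continuous_snd).const_smul r))
        fun x y => by
          rw [← incl_smul, ← incl_mul, ← incl_mul, ← incl_smul, smul_mul_assoc])
      (fun r => p.induction₂
        (isClosed_eq (continuous_fst.mul (continuous_snd.const_smul r))
          ((continuous_fst.mul continuous_snd).const_smul r))
        fun x y => by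
          rw [← incl_smul, ← incl_mul, ← incl_mul, ← incl_smul, mul_smul_comm]) with
    norm_smul_le := fun r x => norm_smul_le r x }

instance : Star p.Completion :=
  ⟨UniformSpace.Completion.map (α := p.Pre) (β := p.Pre) star⟩

theorem incl_star (x : F) : p.incl (star x) = star (p.incl x) :=
  (UniformSpace.Completion.map_coe
    (starNormedAddGroupHom (E := p.Pre)).uniformContinuous (p.toPre x)).symm

theorem continuous_star' : Continuous (star : p.Completion → p.Completion) :=
  UniformSpace.Completion.continuous_map

instance : StarRing p.Completion where
  star_involutive := p.induction
    (isClosed_eq (p.continuous_star'.comp p.continuous_star') continuous_id)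
    fun x => by rw [← incl_star, ← incl_star, star_star]
  star_mul := p.induction₂
    (isClosed_eq (p.continuous_star'.comp (continuous_fst.mul continuous_snd))
      ((p.continuous_star'.comp continuous_snd).mul (p.continuous_star'.comp continuous_fst)))
    fun x y => by rw [← incl_star, ← incl_star, ← incl_mul, ← incl_mul, ← incl_star, star_mul]
  star_add := p.induction₂
    (isClosed_eq (p.continuous_star'.comp (continuous_fst.add continuous_snd))
      ((p.continuous_star'.comp continuous_fst).add (p.continuous_star'.comp continuous_snd)))
    fun x y => by rw [← incl_star, ← incl_star, ← incl_add, ← incl_add, ← incl_star, star_add]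

variable {B : Type*} [CStarAlgebra B]

/-- The continuous extension to the completion of a map dominated by `p`. -/
def extend (f : F →⋆ₐ[ℂ] B) (z : p.Completion) : B :=
  UniformSpace.Completion.extension (fun x : p.Pre => f (p.toPre.symm x)) z

theorem continuous_extend (f : F →⋆ₐ[ℂ] B) : Continuous (p.extend f) :=
  UniformSpace.Completion.continuous_extension (f := fun x : p.Pre => f (p.toPre.symm x))

theorem extend_incl (f : F →⋆ₐ[ℂ] B) (hf : ∀ x, ‖f x‖ ≤ p.toSeminorm x) (x : F) :
    p.extend f (p.incl x) = f x := by
  have hu : UniformContinuous (fun x : p.Pre => f (p.toPre.symm x)) :=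
    AddMonoidHomClass.uniformContinuous_of_bound
      ((f : F →+ B).comp (p.toPre.symm : p.Pre ≃+ F).toAddMonoidHom) 1
        fun x => by rw [one_mul]; exact hf x
  exact UniformSpace.Completion.extension_coe hu (p.toPre x)

/-- The canonical ⋆-homomorphism with dense range from `F` to its completion. -/
def of : F →⋆ₐ[ℂ] p.Completion where
  toFun := p.incl
  map_one' := p.incl_one
  map_mul' := p.incl_mul
  map_zero' := p.incl_zero
  map_add' := p.incl_add
  commutes' r := by
    rw [Algebra.algebraMap_eq_smul_one, Algebra.algebraMap_eq_smul_one, incl_smul, incl_one]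
  map_star' := p.incl_star

theorem norm_of (x : F) : ‖p.of x‖ = p.toSeminorm x := p.norm_incl x

theorem denseRange_of : DenseRange p.of := p.denseRange_incl

variable [StarModule ℂ F]

instance : StarModule ℂ p.Completion where
  star_smul c := p.induction
    (isClosed_eq (p.continuous_star'.comp (continuous_const_smul c))
      ((continuous_const_smul (star c)).comp p.continuous_star'))
    fun x => by rw [← incl_star, ← incl_smul, ← incl_smul, ← incl_star, star_smul]

instance : CStarRing p.Completion where
  norm_mul_self_le := p.induction
    (isClosed_le (continuous_norm.mul continuous_norm)
      (continuous_norm.comp (p.continuous_star'.mul continuous_id)))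
    fun x => by
      rw [← incl_star, ← incl_mul, norm_incl, norm_incl, ← sq]
      exact (p.star_mul_self' x).ge

instance : CStarAlgebra p.Completion where

theorem hom_ext {f g : p.Completion →⋆ₐ[ℂ] B}
    (h : ∀ x, f (p.of x) = g (p.of x)) : f = g := by
  have hf : Continuous f := AddMonoidHomClass.continuous_of_bound f 1 fun z => by
    rw [one_mul]; exact NonUnitalStarAlgHom.norm_apply_le f z
  have hg : Continuous g := AddMonoidHomClass.continuous_of_bound g 1 fun z => by
    rw [one_mul]; exact NonUnitalStarAlgHom.norm_apply_le g z
  exact DFunLike.ext _ _ (p.induction (isClosed_eq hf hg) h)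

/-- A ⋆-homomorphism which is dominated by `p` extends to the completion. -/
def lift (f : F →⋆ₐ[ℂ] B) (hf : ∀ x, ‖f x‖ ≤ p.toSeminorm x) : p.Completion →⋆ₐ[ℂ] B where
  toFun := p.extend f
  map_one' := by rw [← incl_one, extend_incl p f hf, map_one]
  map_zero' := by rw [← incl_zero, extend_incl p f hf, map_zero]
  map_mul' := p.induction₂
    (isClosed_eq ((p.continuous_extend f).comp (continuous_fst.mul continuous_snd))
      (((p.continuous_extend f).comp continuous_fst).mul
        ((p.continuous_extend f).comp continuous_snd)))
    fun x y => by rw [← incl_mul]; simp only [extend_incl p f hf, map_mul]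
  map_add' := p.induction₂
    (isClosed_eq ((p.continuous_extend f).comp (continuous_fst.add continuous_snd))
      (((p.continuous_extend f).comp continuous_fst).add
        ((p.continuous_extend f).comp continuous_snd)))
    fun x y => by rw [← incl_add]; simp only [extend_incl p f hf, map_add]
  commutes' r := by
    rw [Algebra.algebraMap_eq_smul_one, ← incl_one, ← incl_smul, extend_incl p f hf, map_smul,
      map_one, Algebra.algebraMap_eq_smul_one]
  map_star' := p.induction
    (isClosed_eq ((p.continuous_extend f).comp p.continuous_star')
      (continuous_star.comp (p.continuous_extend f)))
    fun x => by rw [← incl_star]; simp only [extend_incl p f hf, map_star]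

@[simp]
theorem lift_of (f : F →⋆ₐ[ℂ] B) (hf : ∀ x, ‖f x‖ ≤ p.toSeminorm x) (x : F) :
    p.lift f hf (p.of x) = f x := p.extend_incl f hf x

end Completion

section Family

variable {F : Type*} [Ring F] [StarRing F] [Algebra ℂ F]

/-- The supremum `x ↦ sup_i ‖f i x‖` of a pointwise bounded family of ⋆-homomorphisms to
C⋆-algebras, as a C⋆-seminorm. -/
def ofFamily {ι : Type*} {B : ι → Type*} [∀ i, CStarAlgebra (B i)] (f : ∀ i, F →⋆ₐ[ℂ] B i)
    (hb : ∀ x, BddAbove (Set.range fun i => ‖f i x‖)) : CStarSeminorm F where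
  toFun x := ⨆ i, ‖f i x‖
  map_zero' := by simp
  add_le' x y := Real.iSup_le (fun i => by
      rw [map_add]
      exact (norm_add_le _ _).trans (add_le_add (le_ciSup (hb x) i) (le_ciSup (hb y) i)))
    (add_nonneg (Real.iSup_nonneg fun _ => norm_nonneg _) (Real.iSup_nonneg fun _ => norm_nonneg _))
  neg' x := by simp
  smul' a x := by simp [norm_smul, Real.mul_iSup_of_nonneg]
  mul_le' x y := Real.iSup_le (fun i => by
      rw [map_mul]
      exact (norm_mul_le _ _).trans (mul_le_mul (le_ciSup (hb x) i) (le_ciSup (hb y) i)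
        (norm_nonneg _) (Real.iSup_nonneg fun _ => norm_nonneg _)))
    (mul_nonneg (Real.iSup_nonneg fun _ => norm_nonneg _) (Real.iSup_nonneg fun _ => norm_nonneg _))
  star_mul_self' x := by
    simp only [map_mul, map_star, CStarRing.norm_star_mul_self, ← sq]
    have hs : 0 ≤ ⨆ i, ‖f i x‖ := Real.iSup_nonneg fun _ => norm_nonneg _
    have hq : 0 ≤ ⨆ i, ‖f i x‖ ^ 2 := Real.iSup_nonneg fun _ => sq_nonneg _
    have hle : ∀ i, ‖f i x‖ ^ 2 ≤ (⨆ i, ‖f i x‖) ^ 2 := fun i =>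
      pow_le_pow_left₀ (norm_nonneg _) (le_ciSup (hb x) i) 2
    refine le_antisymm (Real.iSup_le hle (sq_nonneg _)) ?_
    rw [← Real.le_sqrt hs hq]
    refine Real.iSup_le (fun i => ?_) (Real.sqrt_nonneg _)
    rw [Real.le_sqrt (norm_nonneg _) hq]
    exact le_ciSup (f := fun i => ‖f i x‖ ^ 2) ⟨_, Set.forall_mem_range.2 hle⟩ i

theorem ofFamily_apply {ι : Type*} {B : ι → Type*} [∀ i, CStarAlgebra (B i)]
    (f : ∀ i, F →⋆ₐ[ℂ] B i) (hb : ∀ x, BddAbove (Set.range fun i => ‖f i x‖)) (x : F) :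
    (ofFamily f hb).toSeminorm x = ⨆ i, ‖f i x‖ := rfl

theorem le_ofFamily {ι : Type*} {B : ι → Type*} [∀ i, CStarAlgebra (B i)]
    (f : ∀ i, F →⋆ₐ[ℂ] B i) (hb : ∀ x, BddAbove (Set.range fun i => ‖f i x‖)) (i : ι) (x : F) :
    ‖f i x‖ ≤ (ofFamily f hb).toSeminorm x := le_ciSup (hb x) i

end Family

end CStarSeminorm

/-! ### The minimal tensor product -/

section HilbertTensor

variable (H K : Type*) [NormedAddCommGroup H] [InnerProductSpace ℂ H]
  [NormedAddCommGroup K] [InnerProductSpace ℂ K]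

/-- The Hilbert space tensor product of `H` and `K`: the completion of the algebraic tensor
product with respect to the inner product `⟪a ⊗ b, c ⊗ d⟫ = ⟪a, c⟫ * ⟪b, d⟫`. -/
def HilbertTensor : Type _ := UniformSpace.Completion (H ⊗[ℂ] K)

variable {H K}

namespace HilbertTensor

instance : NormedAddCommGroup (HilbertTensor H K) :=
  inferInstanceAs (NormedAddCommGroup (UniformSpace.Completion (H ⊗[ℂ] K)))
instance : InnerProductSpace ℂ (HilbertTensor H K) :=
  inferInstanceAs (InnerProductSpace ℂ (UniformSpace.Completion (H ⊗[ℂ] K)))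
instance : CompleteSpace (HilbertTensor H K) :=
  inferInstanceAs (CompleteSpace (UniformSpace.Completion (H ⊗[ℂ] K)))

/-- The inclusion of the algebraic tensor product. -/
def incl : H ⊗[ℂ] K →ₗᵢ[ℂ] HilbertTensor H K :=
  UniformSpace.Completion.toComplₗᵢ (𝕜 := ℂ) (E := H ⊗[ℂ] K)

/-- The elementary tensor `h ⊗ k`. -/
def tmul (h : H) (k : K) : HilbertTensor H K := incl (h ⊗ₜ[ℂ] k)

theorem denseRange_incl : DenseRange (incl : H ⊗[ℂ] K → HilbertTensor H K) :=
  UniformSpace.Completion.denseRange_coe (α := H ⊗[ℂ] K)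

theorem inner_tmul (h h' : H) (k k' : K) :
    ⟪tmul h k, tmul h' k'⟫_ℂ = ⟪h, h'⟫_ℂ * ⟪k, k'⟫_ℂ := by
  rw [tmul, tmul, LinearIsometry.inner_map_map, TensorProduct.inner_tmul]

/-- The bounded operator `S ⊗ T` on the Hilbert space tensor product. -/
def map (S : H →L[ℂ] H) (T : K →L[ℂ] K) : HilbertTensor H K →L[ℂ] HilbertTensor H K :=
  (TensorProduct.mapL S T).completion

@[simp]
theorem map_tmul (S : H →L[ℂ] H) (T : K →L[ℂ] K) (h : H) (k : K) :
    map S T (tmul h k) = tmul (S h) (T k) :=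
  ContinuousLinearMap.completion_apply_coe (TensorProduct.mapL S T) (h ⊗ₜ[ℂ] k)

theorem span_tmul_dense (z : HilbertTensor H K) :
    z ∈ closure (Submodule.span ℂ (Set.range fun q : H × K => tmul q.1 q.2) :
      Set (HilbertTensor H K)) := by
  refine closure_mono ?_ (denseRange_incl z)
  rintro _ ⟨x, rfl⟩
  induction x with
  | zero => rw [map_zero]; exact Submodule.zero_mem _
  | tmul h k => exact Submodule.subset_span ⟨(h, k), rfl⟩
  | add x y hx hy =>
    rw [map_add]
    exact Submodule.add_mem _ hx hy

theorem clm_ext {E : Type*} [NormedAddCommGroup E] [NormedSpace ℂ E]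
    {S T : HilbertTensor H K →L[ℂ] E} (h : ∀ a b, S (tmul a b) = T (tmul a b)) : S = T := by
  refine ContinuousLinearMap.ext_on (s := Set.range fun q : H × K => tmul q.1 q.2)
    (fun z => span_tmul_dense z) ?_
  rintro _ ⟨q, rfl⟩
  exact h _ _

theorem eq_of_inner_tmul {x y : HilbertTensor H K} (h : ∀ a b, ⟪tmul a b, x⟫_ℂ = ⟪tmul a b, y⟫_ℂ) :
    x = y := by
  have h' : ∀ z : HilbertTensor H K, ⟪x, z⟫_ℂ = ⟪y, z⟫_ℂ := by
    have := clm_ext (S := innerSL ℂ x) (T := innerSL ℂ y) fun a b => by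
      simp only [innerSL_apply_apply]
      rw [← inner_conj_symm, h, inner_conj_symm]
    intro z
    simpa using DFunLike.congr_fun this z
  exact ext_inner_right ℂ h'

theorem tmul_add (h : H) (k k' : K) : tmul h (k + k') = tmul h k + tmul h k' := by
  rw [tmul, TensorProduct.tmul_add, map_add]; rfl

theorem add_tmul (h h' : H) (k : K) : tmul (h + h') k = tmul h k + tmul h' k := by
  rw [tmul, TensorProduct.add_tmul, map_add]; rfl

theorem tmul_smul (c : ℂ) (h : H) (k : K) : tmul h (c • k) = c • tmul h k := by
  rw [tmul, TensorProduct.tmul_smul, map_smul]; rfl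

theorem smul_tmul (c : ℂ) (h : H) (k : K) : tmul (c • h) k = c • tmul h k := by
  rw [tmul, TensorProduct.smul_tmul]; exact tmul_smul c h k

theorem zero_tmul (k : K) : tmul (0 : H) k = 0 := by
  rw [tmul, TensorProduct.zero_tmul, map_zero]

theorem tmul_zero (h : H) : tmul h (0 : K) = 0 := by
  rw [tmul, TensorProduct.tmul_zero, map_zero]

theorem map_mul (S S' : H →L[ℂ] H) (T T' : K →L[ℂ] K) :
    map (S * S') (T * T') = map S T * map S' T' :=
  clm_ext fun a b => by simp

theorem map_one : map (1 : H →L[ℂ] H) (1 : K →L[ℂ] K) = 1 := clm_ext fun a b => by simp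

variable [CompleteSpace H] [CompleteSpace K]

theorem map_star (S : H →L[ℂ] H) (T : K →L[ℂ] K) : map (star S) (star T) = star (map S T) := by
  refine clm_ext fun a b => eq_of_inner_tmul fun c d => ?_
  rw [ContinuousLinearMap.star_eq_adjoint, ContinuousLinearMap.star_eq_adjoint,
    ContinuousLinearMap.star_eq_adjoint, ContinuousLinearMap.adjoint_inner_right, map_tmul,
    map_tmul, inner_tmul, inner_tmul, ContinuousLinearMap.adjoint_inner_right,
    ContinuousLinearMap.adjoint_inner_right]

variable (H K) in
/-- The amplification `S ↦ S ⊗ 1`. -/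
def ampLeft : (H →L[ℂ] H) →⋆ₐ[ℂ] (HilbertTensor H K →L[ℂ] HilbertTensor H K) where
  toFun S := map S 1
  map_one' := map_one
  map_mul' S S' := by rw [← map_mul, one_mul]
  map_zero' := clm_ext fun a b => by simp [zero_tmul]
  map_add' S S' := clm_ext fun a b => by simp only [map_tmul, add_apply, add_tmul]
  commutes' c := clm_ext fun a b => by simp [Algebra.algebraMap_eq_smul_one, smul_tmul]
  map_star' S := by rw [← map_star, star_one]

variable (H K) in
/-- The amplification `T ↦ 1 ⊗ T`. -/
def ampRight : (K →L[ℂ] K) →⋆ₐ[ℂ] (HilbertTensor H K →L[ℂ] HilbertTensor H K) where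
  toFun T := map 1 T
  map_one' := map_one
  map_mul' S S' := by rw [← map_mul, one_mul]
  map_zero' := clm_ext fun a b => by simp [tmul_zero]
  map_add' S S' := clm_ext fun a b => by simp only [map_tmul, add_apply, tmul_add]
  commutes' c := clm_ext fun a b => by simp [Algebra.algebraMap_eq_smul_one, tmul_smul]
  map_star' S := by rw [← map_star, star_one]

theorem ampLeft_mul_ampRight (S : H →L[ℂ] H) (T : K →L[ℂ] K) :
    ampLeft H K S * ampRight H K T = map S T := by
  change map S 1 * map 1 T = map S T
  rw [← map_mul, mul_one, one_mul]

theorem ampRight_mul_ampLeft (S : H →L[ℂ] H) (T : K →L[ℂ] K) :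
    ampRight H K T * ampLeft H K S = map S T := by
  change map 1 T * map S 1 = map S T
  rw [← map_mul, mul_one, one_mul]

end HilbertTensor

end HilbertTensor

section AlgebraicTensor

variable {A B E : Type*} [Ring A] [StarRing A] [Algebra ℂ A] [StarModule ℂ A]
  [Ring B] [StarRing B] [Algebra ℂ B] [StarModule ℂ B] [Ring E] [StarRing E] [Algebra ℂ E]

/-- The ⋆-homomorphism `a ⊗ b ↦ f a * g b` on the algebraic tensor product, for ⋆-homomorphisms
`f` and `g` with commuting ranges. -/
def algTensorLift (f : A →⋆ₐ[ℂ] E) (g : B →⋆ₐ[ℂ] E) (h : ∀ a b, Commute (f a) (g b)) :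
    A ⊗[ℂ] B →⋆ₐ[ℂ] E where
  __ := Algebra.TensorProduct.lift (f : A →ₐ[ℂ] E) (g : B →ₐ[ℂ] E) h
  map_star' x := by
    change Algebra.TensorProduct.lift (f : A →ₐ[ℂ] E) (g : B →ₐ[ℂ] E) h (star x)
      = star (Algebra.TensorProduct.lift (f : A →ₐ[ℂ] E) (g : B →ₐ[ℂ] E) h x)
    induction x with
    | zero => simp
    | add x y hx hy => rw [star_add, map_add, hx, hy, map_add, star_add]
    | tmul a b =>
      rw [TensorProduct.star_tmul, Algebra.TensorProduct.lift_tmul,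
        Algebra.TensorProduct.lift_tmul, star_mul]
      change f (star a) * g (star b) = star (g b) * star (f a)
      rw [← map_star, ← map_star]
      exact h _ _

theorem algTensorLift_tmul (f : A →⋆ₐ[ℂ] E) (g : B →⋆ₐ[ℂ] E) (h : ∀ a b, Commute (f a) (g b))
    (a : A) (b : B) : algTensorLift f g h (a ⊗ₜ b) = f a * g b :=
  Algebra.TensorProduct.lift_tmul (f : A →ₐ[ℂ] E) (g : B →ₐ[ℂ] E) h a b

end AlgebraicTensor

/-- A unital ⋆-representation of a C⋆-algebra on a Hilbert space. -/
structure HilbertRep (A : Type u) [CStarAlgebra A] : Type (u + 1) where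
  space : Type u
  [normedAddCommGroup : NormedAddCommGroup space]
  [innerProductSpace : InnerProductSpace ℂ space]
  [completeSpace : CompleteSpace space]
  hom : A →⋆ₐ[ℂ] (space →L[ℂ] space)

attribute [instance] HilbertRep.normedAddCommGroup HilbertRep.innerProductSpace
  HilbertRep.completeSpace

namespace HilbertRep

variable {A B D : Type u} [CStarAlgebra A] [CStarAlgebra B] [CStarAlgebra D]

/-- The pull-back of a representation along a ⋆-homomorphism. -/
abbrev comap (f : A →⋆ₐ[ℂ] B) (π : HilbertRep B) : HilbertRep A where
  space := π.space
  hom := π.hom.comp f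

/-- The representation `π ⊗ ρ` of the algebraic tensor product on the Hilbert space tensor
product, determined by `a ⊗ b ↦ π a ⊗ ρ b`. -/
def tensor (π : HilbertRep A) (ρ : HilbertRep B) : A ⊗[ℂ] B →⋆ₐ[ℂ]
    (HilbertTensor π.space ρ.space →L[ℂ] HilbertTensor π.space ρ.space) :=
  algTensorLift ((HilbertTensor.ampLeft π.space ρ.space).comp π.hom)
    ((HilbertTensor.ampRight π.space ρ.space).comp ρ.hom) fun a b =>
      (HilbertTensor.ampLeft_mul_ampRight (π.hom a) (ρ.hom b)).trans
        (HilbertTensor.ampRight_mul_ampLeft (π.hom a) (ρ.hom b)).symm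

@[simp]
theorem tensor_tmul (π : HilbertRep A) (ρ : HilbertRep B) (a : A) (b : B) :
    π.tensor ρ (a ⊗ₜ b) = HilbertTensor.map (π.hom a) (ρ.hom b) :=
  (algTensorLift_tmul _ _ _ a b).trans (HilbertTensor.ampLeft_mul_ampRight _ _)

theorem bddAbove_tensor (x : A ⊗[ℂ] B) :
    BddAbove (Set.range fun i : HilbertRep A × HilbertRep B => ‖i.1.tensor i.2 x‖) := by
  induction x with
  | zero => exact ⟨0, Set.forall_mem_range.2 fun i => by rw [_root_.map_zero, norm_zero]⟩
  | add x y hx hy =>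
    obtain ⟨M, hM⟩ := hx
    obtain ⟨N, hN⟩ := hy
    refine ⟨M + N, Set.forall_mem_range.2 fun i => ?_⟩
    rw [_root_.map_add]
    exact (norm_add_le _ _).trans
      (add_le_add (Set.forall_mem_range.1 hM i) (Set.forall_mem_range.1 hN i))
  | tmul a b =>
    refine ⟨‖a‖ * ‖b‖, Set.forall_mem_range.2 fun i => ?_⟩
    have h : i.1.tensor i.2 (a ⊗ₜ b) = ((HilbertTensor.ampLeft i.1.space i.2.space).comp i.1.hom) a *
      ((HilbertTensor.ampRight i.1.space i.2.space).comp i.2.hom) b := algTensorLift_tmul _ _ _ a b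
    rw [h]
    exact (norm_mul_le _ _).trans (mul_le_mul
      (NonUnitalStarAlgHom.norm_apply_le _ a) (NonUnitalStarAlgHom.norm_apply_le _ b)
      (norm_nonneg _) (norm_nonneg _))

end HilbertRep

section MinTensor

variable {A B D A' B' : Type u} [CStarAlgebra A] [CStarAlgebra B] [CStarAlgebra D]
  [CStarAlgebra A'] [CStarAlgebra B']

variable (A B) in
/-- The minimal (spatial) C⋆-norm on the algebraic tensor product: the supremum of
`‖(π ⊗ ρ) x‖` over all representations `π` of `A` and `ρ` of `B` on Hilbert spaces. -/
def spatialNorm : CStarSeminorm (A ⊗[ℂ] B) :=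
  CStarSeminorm.ofFamily (fun i : HilbertRep A × HilbertRep B => i.1.tensor i.2)
    HilbertRep.bddAbove_tensor

theorem le_spatialNorm (π : HilbertRep A) (ρ : HilbertRep B) (x : A ⊗[ℂ] B) :
    ‖π.tensor ρ x‖ ≤ (spatialNorm A B).toSeminorm x :=
  le_ciSup (f := fun i : HilbertRep A × HilbertRep B => ‖i.1.tensor i.2 x‖)
    (HilbertRep.bddAbove_tensor x) (π, ρ)

theorem spatialNorm_le {x : A ⊗[ℂ] B} {M : ℝ} (hM : 0 ≤ M)
    (h : ∀ (π : HilbertRep A) (ρ : HilbertRep B), ‖π.tensor ρ x‖ ≤ M) :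
    (spatialNorm A B).toSeminorm x ≤ M :=
  Real.iSup_le (fun i => h i.1 i.2) hM

variable (A B) in
/-- The minimal tensor product of two unital C⋆-algebras: the completion of the algebraic tensor
product in the minimal C⋆-norm. -/
abbrev MinTensor : Type u := (spatialNorm A B).Completion

namespace MinTensor

/-- The canonical map from the algebraic to the minimal tensor product. -/
def ofAlg : A ⊗[ℂ] B →⋆ₐ[ℂ] MinTensor A B := (spatialNorm A B).of

/-- The elementary tensor `a ⊗ b`. -/
def tmul (a : A) (b : B) : MinTensor A B := ofAlg (a ⊗ₜ b)

theorem tmul_mul (a a' : A) (b b' : B) : tmul a b * tmul a' b' = tmul (a * a') (b * b') := by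
  rw [tmul, tmul, tmul, ← map_mul, Algebra.TensorProduct.tmul_mul_tmul]

theorem hom_ext {E : Type*} [CStarAlgebra E] {f g : MinTensor A B →⋆ₐ[ℂ] E}
    (h : ∀ a b, f (tmul a b) = g (tmul a b)) : f = g := by
  refine (spatialNorm A B).hom_ext fun x => ?_
  induction x with
  | zero => simp
  | add x y hx hy => simp only [map_add, hx, hy]
  | tmul a b => exact h a b

variable (A B) in
/-- `a ↦ a ⊗ 1`. -/
def inlHom : A →⋆ₐ[ℂ] MinTensor A B where
  toFun a := tmul a 1
  map_one' := map_one ofAlg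
  map_mul' a a' := by rw [tmul_mul, one_mul]
  map_zero' := by rw [tmul, TensorProduct.zero_tmul, map_zero]
  map_add' a a' := by rw [tmul, TensorProduct.add_tmul, map_add]; rfl
  commutes' r := by
    exact AlgHomClass.commutes (ofAlg (A := A) (B := B)) r
  map_star' a := by rw [tmul, tmul, ← map_star, TensorProduct.star_tmul, star_one]

variable (A B) in
/-- `b ↦ 1 ⊗ b`. -/
def inrHom : B →⋆ₐ[ℂ] MinTensor A B where
  toFun b := tmul 1 b
  map_one' := map_one ofAlg
  map_mul' a a' := by rw [tmul_mul, one_mul]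
  map_zero' := by rw [tmul, TensorProduct.tmul_zero, map_zero]
  map_add' a a' := by rw [tmul, TensorProduct.tmul_add, map_add]; rfl
  commutes' r := by
    rw [tmul, Algebra.algebraMap_eq_smul_one, ← TensorProduct.smul_tmul,
      ← Algebra.algebraMap_eq_smul_one]
    exact AlgHomClass.commutes (ofAlg (A := A) (B := B)) r
  map_star' a := by rw [tmul, tmul, ← map_star, TensorProduct.star_tmul, star_one]

theorem inl_mul_inr (a : A) (b : B) : inlHom A B a * inrHom A B b = tmul a b := by
  change tmul a 1 * tmul 1 b = _
  rw [tmul_mul, one_mul, mul_one]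

theorem inr_mul_inl (a : A) (b : B) : inrHom A B b * inlHom A B a = tmul a b := by
  change tmul 1 b * tmul a 1 = _
  rw [tmul_mul, one_mul, mul_one]

/-- The ⋆-homomorphism `a ⊗ b ↦ f a ⊗ g b` on the algebraic tensor product. -/
def algMap (f : A →⋆ₐ[ℂ] A') (g : B →⋆ₐ[ℂ] B') : A ⊗[ℂ] B →⋆ₐ[ℂ] MinTensor A' B' :=
  algTensorLift ((inlHom A' B').comp f) ((inrHom A' B').comp g) fun a b =>
    (inl_mul_inr (f a) (g b)).trans (inr_mul_inl (f a) (g b)).symm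

theorem algMap_tmul (f : A →⋆ₐ[ℂ] A') (g : B →⋆ₐ[ℂ] B') (a : A) (b : B) :
    algMap f g (a ⊗ₜ b) = tmul (f a) (g b) :=
  (algTensorLift_tmul _ _ _ a b).trans (inl_mul_inr (f a) (g b))

theorem exists_algMap_eq (f : A →⋆ₐ[ℂ] A') (g : B →⋆ₐ[ℂ] B') (x : A ⊗[ℂ] B) :
    ∃ y : A' ⊗[ℂ] B', algMap f g x = ofAlg y ∧ ∀ (π : HilbertRep A') (ρ : HilbertRep B'),
      π.tensor ρ y = (π.comap f).tensor (ρ.comap g) x := by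
  induction x with
  | zero => exact ⟨0, by rw [map_zero, map_zero], fun π ρ => by rw [map_zero, map_zero]⟩
  | add x₁ x₂ h₁ h₂ =>
    obtain ⟨y₁, h₁, h₁'⟩ := h₁
    obtain ⟨y₂, h₂, h₂'⟩ := h₂
    exact ⟨y₁ + y₂, by rw [map_add, map_add, h₁, h₂], fun π ρ => by
      rw [map_add, map_add, h₁', h₂']⟩
  | tmul a b =>
    exact ⟨f a ⊗ₜ g b, algMap_tmul f g a b, fun π ρ =>
      (HilbertRep.tensor_tmul π ρ (f a) (g b)).trans
        (HilbertRep.tensor_tmul (π.comap f) (ρ.comap g) a b).symm⟩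

theorem norm_algMap_le (f : A →⋆ₐ[ℂ] A') (g : B →⋆ₐ[ℂ] B') (x : A ⊗[ℂ] B) :
    ‖algMap f g x‖ ≤ (spatialNorm A B).toSeminorm x := by
  obtain ⟨y, hy, hy'⟩ := exists_algMap_eq f g x
  rw [hy, ofAlg, CStarSeminorm.norm_of]
  refine spatialNorm_le (apply_nonneg _ _) fun π ρ => ?_
  rw [hy']
  exact le_spatialNorm (π.comap f) (ρ.comap g) x

/-- The ⋆-homomorphism `f ⊗ g` between minimal tensor products, determined by
`a ⊗ b ↦ f a ⊗ g b`. -/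
def map (f : A →⋆ₐ[ℂ] A') (g : B →⋆ₐ[ℂ] B') : MinTensor A B →⋆ₐ[ℂ] MinTensor A' B' :=
  (spatialNorm A B).lift (algMap f g) (norm_algMap_le f g)

@[simp]
theorem map_tmul (f : A →⋆ₐ[ℂ] A') (g : B →⋆ₐ[ℂ] B') (a : A) (b : B) :
    map f g (tmul a b) = tmul (f a) (g b) :=
  ((spatialNorm A B).lift_of _ _ _).trans (algMap_tmul f g a b)

/-- The representation of the minimal tensor product which extends `π ⊗ ρ`. -/
abbrev rep (π : HilbertRep A) (ρ : HilbertRep B) : HilbertRep (MinTensor A B) where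
  space := HilbertTensor π.space ρ.space
  hom := (spatialNorm A B).lift (π.tensor ρ) (le_spatialNorm π ρ)

theorem rep_ofAlg (π : HilbertRep A) (ρ : HilbertRep B) (x : A ⊗[ℂ] B) :
    (rep π ρ).hom (ofAlg x) = π.tensor ρ x :=
  (spatialNorm A B).lift_of (π.tensor ρ) (le_spatialNorm π ρ) x

theorem rep_tmul (π : HilbertRep A) (ρ : HilbertRep B) (a : A) (b : B) :
    (rep π ρ).hom (tmul a b) = HilbertTensor.map (π.hom a) (ρ.hom b) :=
  (rep_ofAlg π ρ _).trans (HilbertRep.tensor_tmul π ρ a b)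

end MinTensor

end MinTensor

section Independence

/-- The negative part of a self-adjoint element. -/
theorem exists_negPart {M : Type*} [CStarAlgebra M] (Y : M) (hY : star Y = Y) :
    ∃ N W : M, N = star W * W ∧ Y * N = -(N * N) ∧ (N = 0 → ∃ V, Y = star V * V) := by
  let _ : PartialOrder M := CStarAlgebra.spectralOrder M
  have _ : StarOrderedRing M := CStarAlgebra.spectralOrderedRing M
  have hsa : IsSelfAdjoint Y := hY
  obtain ⟨W, hW⟩ := CStarAlgebra.nonneg_iff_eq_star_mul_self.mp (CFC.negPart_nonneg Y)
  refine ⟨Y⁻, W, hW, ?_, fun hz => ?_⟩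
  · conv_lhs => rw [← CFC.posPart_sub_negPart Y hsa]
    rw [sub_mul, CFC.posPart_sub_negPart Y hsa, CFC.posPart_mul_negPart, zero_sub]
  · refine CStarAlgebra.nonneg_iff_eq_star_mul_self.mp ?_
    rw [← CFC.posPart_sub_negPart Y hsa, hz, sub_zero]
    exact CFC.posPart_nonneg Y

namespace HilbertRep

variable {A E : Type u} [CStarAlgebra A] [CStarAlgebra E] {n : ℕ}

/-- The action of a matrix over `E` on `n`-tuples of vectors. -/
def act (ρ : HilbertRep E) (X : CStarMatrix (Fin n) (Fin n) E) (η : Fin n → ρ.space) :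
    Fin n → ρ.space := fun k => ∑ l, ρ.hom (X k l) (η l)

theorem act_mul (ρ : HilbertRep E) (X Y : CStarMatrix (Fin n) (Fin n) E)
    (η : Fin n → ρ.space) : ρ.act (X * Y) η = ρ.act X (ρ.act Y η) := by
  funext k
  simp only [act, CStarMatrix.mul_apply, map_sum, map_mul, sum_apply,
    mul_apply_eq_comp]
  exact Finset.sum_comm

theorem inner_hom_star (ρ : HilbertRep E) (a : E) (h k : ρ.space) :
    ⟪ρ.hom (star a) h, k⟫_ℂ = ⟪h, ρ.hom a k⟫_ℂ := by
  rw [map_star, ContinuousLinearMap.star_eq_adjoint, ContinuousLinearMap.adjoint_inner_left]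

theorem inner_act_star (ρ : HilbertRep E) (X : CStarMatrix (Fin n) (Fin n) E)
    (ζ η : Fin n → ρ.space) :
    ∑ k, ⟪ρ.act (star X) ζ k, η k⟫_ℂ = ∑ k, ⟪ζ k, ρ.act X η k⟫_ℂ := by
  simp only [act, sum_inner, inner_sum, CStarMatrix.star_apply, inner_hom_star]
  exact Finset.sum_comm

/-- The quadratic form of a matrix over `E` in the representation `ρ`. -/
def form (ρ : HilbertRep E) (X : CStarMatrix (Fin n) (Fin n) E) (η : Fin n → ρ.space) : ℂ :=
  ∑ k, ⟪η k, ρ.act X η k⟫_ℂ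

theorem form_conj (ρ : HilbertRep E) (S X : CStarMatrix (Fin n) (Fin n) E)
    (η : Fin n → ρ.space) : ρ.form (star S * X * S) η = ρ.form X (ρ.act S η) := by
  rw [form, form, mul_assoc, act_mul, act_mul, ← inner_act_star, star_star]

theorem form_star_mul_self (ρ : HilbertRep E) (S : CStarMatrix (Fin n) (Fin n) E)
    (η : Fin n → ρ.space) : ρ.form (star S * S) η = ((∑ k, ‖ρ.act S η k‖ ^ 2 : ℝ) : ℂ) := by
  rw [form, act_mul, ← inner_act_star, star_star]
  simp [inner_self_eq_norm_sq_to_K]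

/-- Positivity of a matrix over `E` may be tested on any separating set of representations. -/
theorem exists_eq_star_mul_self (S : Set (HilbertRep E))
    (hS : ∀ e : E, (∀ ρ ∈ S, ρ.hom e = 0) → e = 0) (Y : CStarMatrix (Fin n) (Fin n) E)
    (hY : star Y = Y) (h : ∀ ρ ∈ S, ∀ η : Fin n → ρ.space, 0 ≤ (ρ.form Y η).re) :
    ∃ W, Y = star W * W := by
  let _ : PartialOrder E := CStarAlgebra.spectralOrder E
  have _ : StarOrderedRing E := CStarAlgebra.spectralOrderedRing E
  obtain ⟨N, W, hW, hN, hfin⟩ : ∃ N W : CStarMatrix (Fin n) (Fin n) E, N = star W * W ∧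
    Y * N = -(N * N) ∧ (N = 0 → ∃ V, Y = star V * V) := exists_negPart Y hY
  have hns : star N = N := by rw [hW, star_mul, star_star]
  have key : star N * Y * N = - (star (W * N) * (W * N)) := by
    rw [star_mul, hns, mul_assoc, hN, mul_neg, mul_assoc, ← mul_assoc (star W), ← hW]
  have hV : W * N = 0 := by
    ext m l
    refine hS _ fun ρ hρ => ContinuousLinearMap.ext fun ξ => ?_
    have h2 := h ρ hρ (ρ.act N (Pi.single l ξ))
    have h3 : ρ.form (-(star (W * N) * (W * N))) (Pi.single l ξ)
        = - ρ.form (star (W * N) * (W * N)) (Pi.single l ξ) := by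
      simp only [form, act, CStarMatrix.neg_apply, map_neg, neg_apply, Finset.sum_neg_distrib,
        inner_neg_right]
    rw [← form_conj, key, h3, form_star_mul_self, ← Complex.ofReal_neg, Complex.ofReal_re] at h2
    have h4 : ∑ k, ‖ρ.act (W * N) (Pi.single l ξ) k‖ ^ 2 = 0 :=
      le_antisymm (by linarith) (Finset.sum_nonneg fun _ _ => sq_nonneg _)
    have h5 := (Finset.sum_eq_zero_iff_of_nonneg fun _ _ => sq_nonneg _).1 h4 m (Finset.mem_univ _)
    have h6 : ρ.act (W * N) (Pi.single l ξ) m = 0 := by simpa using h5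
    rw [act, Finset.sum_eq_single l (fun j _ hj => by rw [Pi.single_eq_of_ne hj, map_zero])
      (fun hl => absurd (Finset.mem_univ l) hl), Pi.single_eq_same] at h6
    exact h6
  have hz : star N * N = 0 := by
    rw [hns]
    nth_rewrite 1 [hW]
    rw [mul_assoc, hV, mul_zero]
  exact hfin ((CStarRing.star_mul_self_eq_zero_iff N).1 hz)

/-- The slice map `a ⊗ b ↦ ⟪h, π a h'⟫ b`. -/
def slice (π : HilbertRep A) (h h' : π.space) : A ⊗[ℂ] E →ₗ[ℂ] E :=
  TensorProduct.lift ((LinearMap.lsmul ℂ E).comp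
    (((innerSL ℂ h).comp (ContinuousLinearMap.apply ℂ π.space h')).toLinearMap ∘ₗ
      (π.hom : A →ₗ[ℂ] (π.space →L[ℂ] π.space))))

theorem slice_tmul (π : HilbertRep A) (h h' : π.space) (a : A) (b : E) :
    π.slice h h' (a ⊗ₜ b) = ⟪h, π.hom a h'⟫_ℂ • b := rfl

theorem slice_star (π : HilbertRep A) (h h' : π.space) (x : A ⊗[ℂ] E) :
    π.slice h h' (star x) = star (π.slice h' h x) := by
  induction x with
  | zero => simp
  | add x y hx hy => simp only [star_add, map_add, hx, hy]
  | tmul a b =>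
    rw [TensorProduct.star_tmul, slice_tmul, slice_tmul, star_smul, ← inner_hom_star, star_star]
    congr 1
    exact (inner_conj_symm _ _).symm

theorem inner_tensor (π : HilbertRep A) (ρ : HilbertRep E) (h h' : π.space) (k k' : ρ.space)
    (x : A ⊗[ℂ] E) :
    ⟪HilbertTensor.tmul h k, π.tensor ρ x (HilbertTensor.tmul h' k')⟫_ℂ
      = ⟪k, ρ.hom (π.slice h h' x) k'⟫_ℂ := by
  induction x with
  | zero => simp
  | add x y hx hy => simp only [map_add, add_apply, inner_add_right, hx, hy]
  | tmul a b =>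
    rw [tensor_tmul, HilbertTensor.map_tmul, HilbertTensor.inner_tmul, slice_tmul, map_smul,
      smul_apply, inner_smul_right]

/-- The matrix of slices of `x` with respect to a tuple of vectors. -/
def sliceMatrix (π : HilbertRep A) (e : Fin n → π.space) (x : A ⊗[ℂ] E) :
    CStarMatrix (Fin n) (Fin n) E := CStarMatrix.ofMatrix fun k l => π.slice (e k) (e l) x

theorem form_sliceMatrix (π : HilbertRep A) (ρ : HilbertRep E) (e : Fin n → π.space)
    (η : Fin n → ρ.space) (x : A ⊗[ℂ] E) :
    ρ.form (π.sliceMatrix e x) η = ⟪∑ k, HilbertTensor.tmul (e k) (η k),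
      π.tensor ρ x (∑ k, HilbertTensor.tmul (e k) (η k))⟫_ℂ := by
  simp only [form, act, map_sum, sum_inner, inner_sum, inner_tensor]
  exact Finset.sum_comm

theorem re_inner_tensor (π : HilbertRep A) (ρ : HilbertRep E) (M : ℝ) (x : A ⊗[ℂ] E)
    (z : HilbertTensor π.space ρ.space) :
    (⟪z, π.tensor ρ (((M ^ 2 : ℝ) : ℂ) • 1 - star x * x) z⟫_ℂ).re
      = M ^ 2 * ‖z‖ ^ 2 - ‖π.tensor ρ x z‖ ^ 2 := by
  have h1 : ⟪z, π.tensor ρ (star x * x) z⟫_ℂ = ((‖π.tensor ρ x z‖ ^ 2 : ℝ) : ℂ) := by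
    rw [map_mul, map_star, mul_apply_eq_comp, ContinuousLinearMap.star_eq_adjoint,
      ContinuousLinearMap.adjoint_inner_right, inner_self_eq_norm_sq_to_K]
    simp
  rw [map_sub, map_smul, map_one, sub_apply, inner_sub_right, h1, smul_apply,
    inner_smul_right, one_apply_eq_self, inner_self_eq_norm_sq_to_K, Complex.sub_re,
    Complex.ofReal_re]
  congr 1
  norm_cast
  exact Complex.re_ofReal_mul _ _

/-- The norm of `(π ⊗ σ) x` can be estimated by means of any separating set of representations
in place of `σ`. -/
theorem norm_tensor_le (S : Set (HilbertRep E))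
    (hS : ∀ e : E, (∀ ρ ∈ S, ρ.hom e = 0) → e = 0) (π : HilbertRep A) (σ : HilbertRep E)
    (x : A ⊗[ℂ] E) {M : ℝ} (hM : 0 ≤ M) (h : ∀ ρ ∈ S, ‖π.tensor ρ x‖ ≤ M) :
    ‖π.tensor σ x‖ ≤ M := by
  refine ContinuousLinearMap.opNorm_le_bound _ hM fun z => ?_
  refine HilbertTensor.denseRange_incl.induction_on (p := fun z => ‖π.tensor σ x z‖ ≤ M * ‖z‖) z
    (isClosed_le (by fun_prop) (by fun_prop)) fun w => ?_
  obtain ⟨n, e, η, rfl⟩ := TensorProduct.exists_sum_tmul_eq w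
  set y : A ⊗[ℂ] E := ((M ^ 2 : ℝ) : ℂ) • 1 - star x * x with hy
  have hys : star y = y := by
    rw [hy, star_sub, star_smul, star_mul, star_star, star_one]
    simp
  have hYs : star (π.sliceMatrix e y) = π.sliceMatrix e y := by
    ext k l
    change star (π.slice (e l) (e k) y) = π.slice (e k) (e l) y
    rw [← slice_star, hys]
  obtain ⟨W, hW⟩ := exists_eq_star_mul_self S hS (π.sliceMatrix e y) hYs fun ρ hρ η => by
    rw [form_sliceMatrix, re_inner_tensor, sub_nonneg, ← mul_pow]
    exact pow_le_pow_left₀ (norm_nonneg _)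
      ((ContinuousLinearMap.le_opNorm _ _).trans
        (mul_le_mul_of_nonneg_right (h ρ hρ) (norm_nonneg _))) 2
  have h1 : 0 ≤ (σ.form (π.sliceMatrix e y) η).re := by
    rw [hW, form_star_mul_self, Complex.ofReal_re]
    exact Finset.sum_nonneg fun _ _ => sq_nonneg _
  rw [form_sliceMatrix, re_inner_tensor, sub_nonneg, ← mul_pow] at h1
  have h2 := (sq_le_sq₀ (norm_nonneg _) (mul_nonneg hM (norm_nonneg _))).1 h1
  simpa only [map_sum, HilbertTensor.tmul] using h2

end HilbertRep

end Independence

section Associator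

namespace HilbertTensor

variable {H K L : Type*} [NormedAddCommGroup H] [InnerProductSpace ℂ H]
  [NormedAddCommGroup K] [InnerProductSpace ℂ K] [NormedAddCommGroup L] [InnerProductSpace ℂ L]

/-- `(h ⊗ k) ⊗ l ↦ (h ⊗ k) ⊗ l`, with values in the iterated Hilbert space tensor product. -/
def inclL : (H ⊗[ℂ] K) ⊗[ℂ] L →ₗᵢ[ℂ] HilbertTensor (HilbertTensor H K) L :=
  incl.comp ((incl (H := H) (K := K)).rTensor L)

/-- `(h ⊗ k) ⊗ l ↦ h ⊗ (k ⊗ l)`, with values in the iterated Hilbert space tensor product. -/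
def inclR : (H ⊗[ℂ] K) ⊗[ℂ] L →ₗᵢ[ℂ] HilbertTensor H (HilbertTensor K L) :=
  (incl.comp ((incl (H := K) (K := L)).lTensor H)).comp
    (TensorProduct.assocIsometry ℂ H K L).toLinearIsometry

theorem inclL_tmul (h : H) (k : K) (l : L) :
    inclL ((h ⊗ₜ k) ⊗ₜ l) = tmul (tmul h k) l := rfl

theorem inclR_tmul (h : H) (k : K) (l : L) :
    inclR ((h ⊗ₜ k) ⊗ₜ l) = tmul h (tmul k l) := rfl

theorem inclL_add (x y : H ⊗[ℂ] K) (l : L) :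
    inclL ((x + y) ⊗ₜ l) = inclL (x ⊗ₜ l) + inclL (y ⊗ₜ l) := by
  rw [TensorProduct.add_tmul]; exact LinearIsometry.map_add _ _ _

theorem inclR_add (x y : H ⊗[ℂ] K) (l : L) :
    inclR ((x + y) ⊗ₜ l) = inclR (x ⊗ₜ l) + inclR (y ⊗ₜ l) := by
  rw [TensorProduct.add_tmul]; exact LinearIsometry.map_add _ _ _

theorem inclL_zero (l : L) : inclL ((0 : H ⊗[ℂ] K) ⊗ₜ l) = 0 := by
  rw [TensorProduct.zero_tmul]; exact LinearIsometry.map_zero _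

theorem inclR_zero (l : L) : inclR ((0 : H ⊗[ℂ] K) ⊗ₜ l) = 0 := by
  rw [TensorProduct.zero_tmul]; exact LinearIsometry.map_zero _

/-- `z ↦ h ⊗ z` as a continuous map. -/
def tmulL (h : H) : K →L[ℂ] HilbertTensor H K :=
  incl.toContinuousLinearMap.comp (TensorProduct.mkL ℂ H K h)

theorem denseRange_inclR :
    DenseRange (inclR : (H ⊗[ℂ] K) ⊗[ℂ] L → HilbertTensor H (HilbertTensor K L)) := by
  have h1 : ∀ (h : H) (z : HilbertTensor K L), tmul h z ∈
      (LinearMap.range (inclR (H := H) (K := K) (L := L)).toLinearMap).topologicalClosure := by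
    intro h z
    refine denseRange_incl.induction_on (p := fun z => tmul h z ∈
      (LinearMap.range (inclR (H := H) (K := K) (L := L)).toLinearMap).topologicalClosure) z
      ((Submodule.isClosed_topologicalClosure _).preimage (tmulL h).continuous) fun w => ?_
    refine Submodule.le_topologicalClosure _ ?_
    induction w with
    | zero => rw [map_zero, tmul_zero]; exact Submodule.zero_mem _
    | tmul k l => exact ⟨(h ⊗ₜ k) ⊗ₜ l, rfl⟩
    | add x y hx hy => rw [map_add, tmul_add]; exact Submodule.add_mem _ hx hy
  intro z
  have h2 : (Submodule.span ℂ (Set.range fun q : H × HilbertTensor K L => tmul q.1 q.2)) ≤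
      (LinearMap.range (inclR (H := H) (K := K) (L := L)).toLinearMap).topologicalClosure :=
    Submodule.span_le.2 (by rintro _ ⟨q, rfl⟩; exact h1 q.1 q.2)
  have h3 := closure_mono (SetLike.coe_subset_coe.2 h2) (span_tmul_dense z)
  rw [(Submodule.isClosed_topologicalClosure _).closure_eq] at h3
  exact h3

/-- Two operators on the two iterated tensor products with the same matrix coefficients satisfy
the same norm estimates. -/
theorem norm_le_of_coeff (S : HilbertTensor H (HilbertTensor K L) →L[ℂ]
      HilbertTensor H (HilbertTensor K L))
    (T : HilbertTensor (HilbertTensor H K) L →L[ℂ] HilbertTensor (HilbertTensor H K) L)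
    (hST : ∀ h h' k k' l l', ⟪tmul h (tmul k l), S (tmul h' (tmul k' l'))⟫_ℂ
      = ⟪tmul (tmul h k) l, T (tmul (tmul h' k') l')⟫_ℂ) : ‖S‖ ≤ ‖T‖ := by
  have h1 : ∀ u v : (H ⊗[ℂ] K) ⊗[ℂ] L, ⟪inclR u, S (inclR v)⟫_ℂ = ⟪inclL u, T (inclL v)⟫_ℂ := by
    intro u v
    induction u with
    | zero =>
      refine (congrArg (fun w => ⟪w, S (inclR v)⟫_ℂ) (LinearIsometry.map_zero inclR)).trans
        (Eq.trans ?_ (congrArg (fun w => ⟪w, T (inclL v)⟫_ℂ) (LinearIsometry.map_zero inclL)).symm)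
      simp only [inner_zero_left]
    | add x y hx hy => simp only [map_add, inner_add_left, hx, hy]
    | tmul hk l =>
      induction hk with
      | zero =>
        refine (congrArg (fun w => ⟪w, S (inclR v)⟫_ℂ) (inclR_zero l)).trans
          (Eq.trans ?_ (congrArg (fun w => ⟪w, T (inclL v)⟫_ℂ) (inclL_zero l)).symm)
        simp only [inner_zero_left]
      | add x y hx hy =>
        refine (congrArg (fun w => ⟪w, S (inclR v)⟫_ℂ) (inclR_add x y l)).trans
          (Eq.trans ?_ (congrArg (fun w => ⟪w, T (inclL v)⟫_ℂ) (inclL_add x y l)).symm)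
        simp only [inner_add_left, hx, hy]
      | tmul h k =>
        induction v with
        | zero =>
          refine (congrArg (fun w => ⟪inclR ((h ⊗ₜ k) ⊗ₜ l), S w⟫_ℂ)
            (LinearIsometry.map_zero inclR)).trans (Eq.trans ?_
              (congrArg (fun w => ⟪inclL ((h ⊗ₜ k) ⊗ₜ l), T w⟫_ℂ)
                (LinearIsometry.map_zero inclL)).symm)
          simp only [map_zero, inner_zero_right]
        | add x y hx hy => simp only [map_add, inner_add_right, hx, hy]
        | tmul hk' l' =>
          induction hk' with
          | zero =>
            refine (congrArg (fun w => ⟪inclR ((h ⊗ₜ k) ⊗ₜ l), S w⟫_ℂ) (inclR_zero l')).trans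
              (Eq.trans ?_
                (congrArg (fun w => ⟪inclL ((h ⊗ₜ k) ⊗ₜ l), T w⟫_ℂ) (inclL_zero l')).symm)
            simp only [map_zero, inner_zero_right]
          | add x y hx hy =>
            refine (congrArg (fun w => ⟪inclR ((h ⊗ₜ k) ⊗ₜ l), S w⟫_ℂ) (inclR_add x y l')).trans
              (Eq.trans ?_
                (congrArg (fun w => ⟪inclL ((h ⊗ₜ k) ⊗ₜ l), T w⟫_ℂ) (inclL_add x y l')).symm)
            simp only [map_add, inner_add_right, hx, hy]
          | tmul h' k' => exact hST h h' k k' l l'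
  refine ContinuousLinearMap.opNorm_le_bound _ (norm_nonneg T) fun z => ?_
  refine denseRange_inclR.induction_on (p := fun z => ‖S z‖ ≤ ‖T‖ * ‖z‖) z
    (isClosed_le (by fun_prop) (by fun_prop)) fun v => ?_
  have h2 : ∀ w, ‖⟪w, S (inclR v)⟫_ℂ‖ ≤ ‖w‖ * (‖T‖ * ‖inclR v‖) := fun w => by
    refine denseRange_inclR.induction_on
      (p := fun w => ‖⟪w, S (inclR v)⟫_ℂ‖ ≤ ‖w‖ * (‖T‖ * ‖inclR v‖)) w
      (isClosed_le (by fun_prop) (by fun_prop)) fun u => ?_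
    rw [h1, LinearIsometry.norm_map, LinearIsometry.norm_map, ← inclL.norm_map u,
      ← inclL.norm_map v]
    exact (norm_inner_le_norm _ _).trans
      (mul_le_mul_of_nonneg_left (T.le_opNorm _) (norm_nonneg _))
  have h3 := h2 (S (inclR v))
  rw [inner_self_eq_norm_sq_to_K, norm_pow, sq] at h3
  have h4 : ‖S (inclR v)‖ * ‖S (inclR v)‖ ≤ ‖S (inclR v)‖ * (‖T‖ * ‖inclR v‖) := by simpa using h3
  rcases (norm_nonneg (S (inclR v))).eq_or_lt with h5 | h5
  · rw [← h5]; positivity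
  · exact le_of_mul_le_mul_left h4 h5

end HilbertTensor

namespace MinTensor

variable {A B D : Type u} [CStarAlgebra A] [CStarAlgebra B] [CStarAlgebra D]

theorem continuous_hom {E F : Type*} [CStarAlgebra E] [CStarAlgebra F] (f : E →⋆ₐ[ℂ] F) :
    Continuous f :=
  AddMonoidHomClass.continuous_of_bound f 1 fun z => by
    rw [one_mul]; exact NonUnitalStarAlgHom.norm_apply_le f z

/-- A norm estimate which is known on the algebraic tensor product extends to the completion. -/
theorem norm_le_of_rep (P : HilbertRep A → HilbertRep B → Prop)
    (hP : ∀ (x : A ⊗[ℂ] B) (M : ℝ), 0 ≤ M → (∀ π ρ, P π ρ → ‖π.tensor ρ x‖ ≤ M) →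
      (spatialNorm A B).toSeminorm x ≤ M)
    (z : MinTensor A B) {M : ℝ} (hM : 0 ≤ M) (h : ∀ π ρ, P π ρ → ‖(rep π ρ).hom z‖ ≤ M) :
    ‖z‖ ≤ M := by
  refine le_of_forall_pos_le_add fun ε hε => ?_
  obtain ⟨x, hx⟩ := (spatialNorm A B).denseRange_of.exists_dist_lt z (half_pos hε)
  rw [dist_eq_norm] at hx
  have h1 : (spatialNorm A B).toSeminorm x ≤ M + ε / 2 := by
    refine hP x _ (by positivity) fun π ρ hπρ => ?_
    rw [← rep_ofAlg]
    have h2 : (rep π ρ).hom (ofAlg x) = (rep π ρ).hom z - (rep π ρ).hom (z - ofAlg x) := by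
      rw [map_sub]; abel
    rw [h2]
    exact (norm_sub_le _ _).trans (add_le_add (h π ρ hπρ)
      ((NonUnitalStarAlgHom.norm_apply_le (rep π ρ).hom _).trans hx.le))
  have h3 : z = (z - (spatialNorm A B).of x) + (spatialNorm A B).of x := by abel
  rw [h3]
  refine (norm_add_le _ _).trans ?_
  rw [CStarSeminorm.norm_of]
  linarith

theorem eq_zero_of_rep (z : MinTensor A B) (h : ∀ π ρ, (rep π ρ).hom z = 0) : z = 0 := by
  have h1 := norm_le_of_rep (fun _ _ => True)
    (fun x M hM hx => spatialNorm_le hM fun π ρ => hx π ρ trivial) z le_rfl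
    fun π ρ _ => by rw [h π ρ, norm_zero]
  exact norm_le_zero_iff.1 h1

/-- The norm of an iterated tensor product is determined by triples of representations. -/
theorem norm_le_of_rep_rep (z : MinTensor A (MinTensor B D)) {M : ℝ} (hM : 0 ≤ M)
    (h : ∀ π ρ τ, ‖(rep π (rep ρ τ)).hom z‖ ≤ M) : ‖z‖ ≤ M := by
  refine norm_le_of_rep (fun _ σ => σ ∈ {σ | ∃ ρ τ, σ = rep ρ τ}) (fun x N hN hx => ?_) z hM ?_
  · refine spatialNorm_le hN fun π σ => ?_
    refine HilbertRep.norm_tensor_le {σ | ∃ ρ τ, σ = rep ρ τ} (fun e he => ?_) π σ x hN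
      fun ρ hρ => hx π ρ hρ
    exact eq_zero_of_rep e fun ρ τ => he _ ⟨ρ, τ, rfl⟩
  · rintro π _ ⟨ρ, τ, rfl⟩
    exact h π ρ τ

variable (A B D) in
/-- The ⋆-homomorphism `(a ⊗ b) ⊗ d ↦ a ⊗ (b ⊗ d)` before completion. -/
def algAssoc : (MinTensor A B) ⊗[ℂ] D →⋆ₐ[ℂ] MinTensor A (MinTensor B D) :=
  algTensorLift (map (StarAlgHom.id ℂ A) (inlHom B D))
    ((inrHom A (MinTensor B D)).comp (inrHom B D)) fun z d => by
      refine (spatialNorm A B).induction (P := fun z => Commute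
        (map (StarAlgHom.id ℂ A) (inlHom B D) z)
        (((inrHom A (MinTensor B D)).comp (inrHom B D)) d)) ?_ (fun x => ?_) z
      · exact isClosed_eq ((continuous_hom _).mul continuous_const)
          (continuous_const.mul (continuous_hom _))
      · change Commute (map (StarAlgHom.id ℂ A) (inlHom B D) (ofAlg x)) _
        induction x with
        | zero => rw [map_zero, map_zero]; exact Commute.zero_left _
        | add x y hx hy => rw [map_add, map_add]; exact hx.add_left hy
        | tmul a b =>
          change Commute (map (StarAlgHom.id ℂ A) (inlHom B D) (tmul a b)) (tmul 1 (tmul 1 d))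
          rw [map_tmul, commute_iff_eq, tmul_mul, tmul_mul]
          change tmul (a * 1) (tmul b 1 * tmul 1 d) = tmul (1 * a) (tmul 1 d * tmul b 1)
          rw [tmul_mul, tmul_mul, mul_one, one_mul, mul_one, one_mul, mul_one, one_mul]

theorem algAssoc_tmul (z : MinTensor A B) (d : D) :
    algAssoc A B D (z ⊗ₜ d) = map (StarAlgHom.id ℂ A) (inlHom B D) z * tmul 1 (tmul 1 d) :=
  algTensorLift_tmul _ _ _ z d

theorem coeff_map (π : HilbertRep A) (ρ : HilbertRep B) (τ : HilbertRep D)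
    (h h' : π.space) (k k' : ρ.space) (l l' : τ.space) (z : MinTensor A B) :
    ⟪HilbertTensor.tmul h (HilbertTensor.tmul k l),
      (rep π (rep ρ τ)).hom (map (StarAlgHom.id ℂ A) (inlHom B D) z)
        (HilbertTensor.tmul h' (HilbertTensor.tmul k' l'))⟫_ℂ
      = ⟪HilbertTensor.tmul h k, (rep π ρ).hom z (HilbertTensor.tmul h' k')⟫_ℂ * ⟪l, l'⟫_ℂ := by
  refine (spatialNorm A B).induction (P := fun z => ⟪HilbertTensor.tmul h (HilbertTensor.tmul k l),
      (rep π (rep ρ τ)).hom (map (StarAlgHom.id ℂ A) (inlHom B D) z)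
        (HilbertTensor.tmul h' (HilbertTensor.tmul k' l'))⟫_ℂ
      = ⟪HilbertTensor.tmul h k, (rep π ρ).hom z (HilbertTensor.tmul h' k')⟫_ℂ * ⟪l, l'⟫_ℂ)
      ?_ (fun x => ?_) z
  · have h1 : Continuous (rep π (rep ρ τ)).hom := continuous_hom _
    have h2 : Continuous (map (StarAlgHom.id ℂ A) (inlHom B D)) := continuous_hom _
    have h3 : Continuous (rep π ρ).hom := continuous_hom _
    refine isClosed_eq ?_ ?_
    · exact continuous_const.inner ((h1.comp h2).clm_apply continuous_const)
    · exact (continuous_const.inner (h3.clm_apply continuous_const)).mul continuous_const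
  · change ⟪HilbertTensor.tmul h (HilbertTensor.tmul k l),
      (rep π (rep ρ τ)).hom (map (StarAlgHom.id ℂ A) (inlHom B D) (ofAlg x))
        (HilbertTensor.tmul h' (HilbertTensor.tmul k' l'))⟫_ℂ
      = ⟪HilbertTensor.tmul h k, (rep π ρ).hom (ofAlg x) (HilbertTensor.tmul h' k')⟫_ℂ * ⟪l, l'⟫_ℂ
    induction x with
    | zero => simp only [map_zero, zero_apply, inner_zero_right, zero_mul]
    | add x y hx hy => simp only [map_add, add_apply, inner_add_right, add_mul, hx, hy]
    | tmul a b =>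
      have h1 : (rep π (rep ρ τ)).hom (map (StarAlgHom.id ℂ A) (inlHom B D) (tmul a b))
          (HilbertTensor.tmul h' (HilbertTensor.tmul k' l'))
          = HilbertTensor.tmul (π.hom a h') (HilbertTensor.tmul (ρ.hom b k') l') := by
        rw [map_tmul, rep_tmul]
        refine (HilbertTensor.map_tmul _ _ _ _).trans ?_
        congr 1
        change (rep ρ τ).hom (tmul b 1) _ = _
        rw [rep_tmul, map_one]
        exact HilbertTensor.map_tmul _ _ _ _
      have h2 : (rep π ρ).hom (tmul a b) (HilbertTensor.tmul h' k')
          = HilbertTensor.tmul (π.hom a h') (ρ.hom b k') := by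
        rw [rep_tmul]; exact HilbertTensor.map_tmul _ _ _ _
      change ⟪HilbertTensor.tmul h (HilbertTensor.tmul k l),
        (rep π (rep ρ τ)).hom (map (StarAlgHom.id ℂ A) (inlHom B D) (tmul a b))
          (HilbertTensor.tmul h' (HilbertTensor.tmul k' l'))⟫_ℂ
        = ⟪HilbertTensor.tmul h k, (rep π ρ).hom (tmul a b) (HilbertTensor.tmul h' k')⟫_ℂ * ⟪l, l'⟫_ℂ
      rw [h1, h2]
      refine (HilbertTensor.inner_tmul _ _ _ _).trans ?_
      rw [HilbertTensor.inner_tmul, HilbertTensor.inner_tmul, mul_assoc]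

theorem coeff_algAssoc (π : HilbertRep A) (ρ : HilbertRep B) (τ : HilbertRep D)
    (h h' : π.space) (k k' : ρ.space) (l l' : τ.space) (x : (MinTensor A B) ⊗[ℂ] D) :
    ⟪HilbertTensor.tmul h (HilbertTensor.tmul k l), (rep π (rep ρ τ)).hom (algAssoc A B D x)
        (HilbertTensor.tmul h' (HilbertTensor.tmul k' l'))⟫_ℂ
      = ⟪HilbertTensor.tmul (HilbertTensor.tmul h k) l, (rep π ρ).tensor τ x
        (HilbertTensor.tmul (HilbertTensor.tmul h' k') l')⟫_ℂ := by
  induction x with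
  | zero => simp only [map_zero, zero_apply, inner_zero_right]
  | add x y hx hy => simp only [map_add, add_apply, inner_add_right, hx, hy]
  | tmul z d =>
    have h1 : (rep π (rep ρ τ)).hom (tmul 1 (tmul 1 d))
        (HilbertTensor.tmul h' (HilbertTensor.tmul k' l'))
        = HilbertTensor.tmul h' (HilbertTensor.tmul k' (τ.hom d l')) := by
      rw [rep_tmul, rep_tmul, map_one, map_one]
      refine (HilbertTensor.map_tmul _ _ _ _).trans ?_
      congr 1
      exact HilbertTensor.map_tmul _ _ _ _
    rw [algAssoc_tmul, map_mul, mul_apply_eq_comp, h1, coeff_map, HilbertRep.tensor_tmul,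
      HilbertTensor.map_tmul]
    exact (HilbertTensor.inner_tmul _ _ _ _).symm

theorem norm_algAssoc_le (x : (MinTensor A B) ⊗[ℂ] D) :
    ‖algAssoc A B D x‖ ≤ (spatialNorm (MinTensor A B) D).toSeminorm x := by
  refine norm_le_of_rep_rep _ (apply_nonneg _ _) fun π ρ τ => ?_
  refine le_trans ?_ (le_spatialNorm (rep π ρ) τ x)
  exact HilbertTensor.norm_le_of_coeff _ _ fun h h' k k' l l' =>
    coeff_algAssoc π ρ τ h h' k k' l l' x

variable (A B D) in
/-- The canonical identification `(A ⊗ B) ⊗ D → A ⊗ (B ⊗ D)`, determined by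
`(a ⊗ b) ⊗ d ↦ a ⊗ (b ⊗ d)`. -/
def assoc : MinTensor (MinTensor A B) D →⋆ₐ[ℂ] MinTensor A (MinTensor B D) :=
  (spatialNorm (MinTensor A B) D).lift (algAssoc A B D) norm_algAssoc_le

@[simp]
theorem assoc_tmul (a : A) (b : B) (d : D) :
    assoc A B D (tmul (tmul a b) d) = tmul a (tmul b d) := by
  refine ((spatialNorm (MinTensor A B) D).lift_of _ norm_algAssoc_le _).trans ?_
  rw [algAssoc_tmul, map_tmul, tmul_mul, mul_one]
  change tmul a (tmul b 1 * tmul 1 d) = _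
  rw [tmul_mul, mul_one, one_mul]

end MinTensor

end Associator

/-! ### The free product -/

section FreeStarAlgebra

/-- The opposite ring of `F`, with the complex conjugate scalar multiplication. -/
def ConjOpposite (F : Type*) : Type _ := Fᵐᵒᵖ

/-- The element of the opposite ring given by an element of `F`. -/
def ConjOpposite.op {F : Type*} (x : F) : ConjOpposite F := MulOpposite.op x

/-- The underlying element of `F`. -/
def ConjOpposite.unop {F : Type*} (x : ConjOpposite F) : F := MulOpposite.unop x

instance (F : Type*) [Ring F] : Ring (ConjOpposite F) := inferInstanceAs (Ring Fᵐᵒᵖ)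

instance (F : Type*) [Ring F] [Algebra ℂ F] : Algebra ℂ (ConjOpposite F) :=
  RingHom.toAlgebra' ((algebraMap ℂ Fᵐᵒᵖ).comp (starRingEnd ℂ) : ℂ →+* Fᵐᵒᵖ)
    fun c x => Algebra.commutes (A := Fᵐᵒᵖ) (starRingEnd ℂ c) x

/-- The free complex ⋆-algebra generated by the elements of `A₁` and of `A₂`, in which the
involution of the generators is that of `A₁` and `A₂`. -/
def FreeStarAlgebra (A₁ A₂ : Type*) : Type _ := FreeAlgebra ℂ (A₁ ⊕ A₂)

namespace FreeStarAlgebra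

variable {A₁ A₂ : Type*}

instance : Ring (FreeStarAlgebra A₁ A₂) := inferInstanceAs (Ring (FreeAlgebra ℂ (A₁ ⊕ A₂)))
instance : Algebra ℂ (FreeStarAlgebra A₁ A₂) :=
  inferInstanceAs (Algebra ℂ (FreeAlgebra ℂ (A₁ ⊕ A₂)))

/-- The generators. -/
def gen (s : A₁ ⊕ A₂) : FreeStarAlgebra A₁ A₂ := FreeAlgebra.ι ℂ s

theorem induction {P : FreeStarAlgebra A₁ A₂ → Prop} (hs : ∀ c : ℂ, P (algebraMap ℂ _ c))
    (hg : ∀ s, P (gen s)) (hm : ∀ x y, P x → P y → P (x * y)) (ha : ∀ x y, P x → P y → P (x + y))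
    (x : FreeStarAlgebra A₁ A₂) : P x :=
  FreeAlgebra.induction ℂ (A₁ ⊕ A₂) hs hg hm ha x

section Star

variable [Star A₁] [Star A₂]

/-- The involution, as a homomorphism to the conjugate opposite algebra. -/
def starHom : FreeStarAlgebra A₁ A₂ →ₐ[ℂ] ConjOpposite (FreeStarAlgebra A₁ A₂) :=
  FreeAlgebra.lift ℂ fun s => ConjOpposite.op (gen (s.map star star))

instance : Star (FreeStarAlgebra A₁ A₂) :=
  ⟨fun x => ConjOpposite.unop (starHom x)⟩

theorem star_gen (s : A₁ ⊕ A₂) : star (gen s) = gen (s.map star star) :=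
  congrArg ConjOpposite.unop (FreeAlgebra.lift_ι_apply (R := ℂ)
    (A := ConjOpposite (FreeStarAlgebra A₁ A₂)) _ s)

theorem star_algebraMap (c : ℂ) : star (algebraMap ℂ (FreeStarAlgebra A₁ A₂) c)
    = algebraMap ℂ (FreeStarAlgebra A₁ A₂) (star c) :=
  congrArg ConjOpposite.unop (AlgHom.commutes
    (starHom : FreeStarAlgebra A₁ A₂ →ₐ[ℂ] ConjOpposite (FreeStarAlgebra A₁ A₂)) c)

theorem star_mul' (x y : FreeStarAlgebra A₁ A₂) : star (x * y) = star y * star x :=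
  congrArg ConjOpposite.unop (map_mul starHom x y)

theorem star_add' (x y : FreeStarAlgebra A₁ A₂) : star (x + y) = star x + star y :=
  congrArg ConjOpposite.unop (map_add starHom x y)

end Star

variable [InvolutiveStar A₁] [InvolutiveStar A₂]

instance : StarRing (FreeStarAlgebra A₁ A₂) where
  star_mul := star_mul'
  star_add := star_add'
  star_involutive := induction
    (fun c => by rw [star_algebraMap, star_algebraMap, star_star])
    (fun s => by rw [star_gen, star_gen]; cases s <;> simp)
    (fun x y hx hy => by rw [star_mul', star_mul', hx, hy])
    (fun x y hx hy => by rw [star_add', star_add', hx, hy])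

instance : StarModule ℂ (FreeStarAlgebra A₁ A₂) where
  star_smul c x := by
    rw [Algebra.smul_def, star_mul, star_algebraMap, Algebra.smul_def, Algebra.commutes]

end FreeStarAlgebra

end FreeStarAlgebra

section FreeProduct

/-- A pair of unital ⋆-homomorphisms from `A₁` and `A₂` to a common unital C⋆-algebra. -/
structure HomPair (A₁ A₂ : Type u) [CStarAlgebra A₁] [CStarAlgebra A₂] : Type (u + 1) where
  target : Type u
  [cstarAlgebra : CStarAlgebra target]
  fst : A₁ →⋆ₐ[ℂ] target
  snd : A₂ →⋆ₐ[ℂ] target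

attribute [instance] HomPair.cstarAlgebra

variable {A₁ A₂ : Type u} [CStarAlgebra A₁] [CStarAlgebra A₂]

namespace HomPair

/-- The ⋆-homomorphism on the free ⋆-algebra which is given by `fst` and `snd` on generators. -/
def eval (f : HomPair A₁ A₂) : FreeStarAlgebra A₁ A₂ →⋆ₐ[ℂ] f.target where
  __ := (FreeAlgebra.lift ℂ (Sum.elim f.fst f.snd) : FreeAlgebra ℂ (A₁ ⊕ A₂) →ₐ[ℂ] f.target)
  map_star' := FreeStarAlgebra.induction
    (fun c => by
      rw [FreeStarAlgebra.star_algebraMap]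
      refine (AlgHom.commutes (FreeAlgebra.lift ℂ (Sum.elim f.fst f.snd)) _).trans ?_
      rw [algebraMap_star_comm]
      exact (congrArg star (AlgHom.commutes (FreeAlgebra.lift ℂ (Sum.elim f.fst f.snd)) c)).symm)
    (fun s => by
      rw [FreeStarAlgebra.star_gen]
      refine (FreeAlgebra.lift_ι_apply (R := ℂ) _ _).trans ?_
      refine Eq.trans ?_ (congrArg star (FreeAlgebra.lift_ι_apply (R := ℂ) _ s)).symm
      cases s <;> simp [map_star])
    (fun x y hx hy => by
      rw [star_mul]
      refine (map_mul (FreeAlgebra.lift ℂ (Sum.elim f.fst f.snd)) _ _).trans ?_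
      refine Eq.trans ?_
        (congrArg star (map_mul (FreeAlgebra.lift ℂ (Sum.elim f.fst f.snd)) x y)).symm
      rw [star_mul]
      exact congrArg₂ (· * ·) hy hx)
    (fun x y hx hy => by
      rw [star_add]
      refine (map_add (FreeAlgebra.lift ℂ (Sum.elim f.fst f.snd)) _ _).trans ?_
      refine Eq.trans ?_
        (congrArg star (map_add (FreeAlgebra.lift ℂ (Sum.elim f.fst f.snd)) x y)).symm
      rw [star_add]
      exact congrArg₂ (· + ·) hx hy)

theorem eval_gen (f : HomPair A₁ A₂) (s : A₁ ⊕ A₂) :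
    f.eval (FreeStarAlgebra.gen s) = Sum.elim f.fst f.snd s :=
  FreeAlgebra.lift_ι_apply (R := ℂ) _ s

theorem bddAbove_eval (x : FreeStarAlgebra A₁ A₂) :
    BddAbove (Set.range fun f : HomPair A₁ A₂ => ‖f.eval x‖) := by
  refine FreeStarAlgebra.induction
    (P := fun x => BddAbove (Set.range fun f : HomPair A₁ A₂ => ‖f.eval x‖)) ?_ ?_ ?_ ?_ x
  · refine fun c => ⟨‖c‖, Set.forall_mem_range.2 fun f => ?_⟩
    rw [AlgHomClass.commutes]
    rcases subsingleton_or_nontrivial f.target with h | h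
    · rw [Subsingleton.elim (algebraMap ℂ f.target c) 0, norm_zero]; exact norm_nonneg c
    · rw [norm_algebraMap']
  · rintro (a | a)
    · refine ⟨‖a‖, Set.forall_mem_range.2 fun f => ?_⟩
      rw [eval_gen]
      exact NonUnitalStarAlgHom.norm_apply_le f.fst a
    · refine ⟨‖a‖, Set.forall_mem_range.2 fun f => ?_⟩
      rw [eval_gen]
      exact NonUnitalStarAlgHom.norm_apply_le f.snd a
  · rintro x y ⟨M, hM⟩ ⟨N, hN⟩
    refine ⟨M * N, Set.forall_mem_range.2 fun f => ?_⟩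
    rw [map_mul]
    exact (norm_mul_le _ _).trans (mul_le_mul (Set.forall_mem_range.1 hM f)
      (Set.forall_mem_range.1 hN f) (norm_nonneg _)
      ((norm_nonneg _).trans (Set.forall_mem_range.1 hM f)))
  · rintro x y ⟨M, hM⟩ ⟨N, hN⟩
    refine ⟨M + N, Set.forall_mem_range.2 fun f => ?_⟩
    rw [map_add]
    exact (norm_add_le _ _).trans (add_le_add (Set.forall_mem_range.1 hM f)
      (Set.forall_mem_range.1 hN f))

end HomPair

variable (A₁ A₂) in
/-- The largest C⋆-seminorm on the free ⋆-algebra which respects the ⋆-algebra structures of `A₁`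
and `A₂`: the supremum over all pairs of unital ⋆-homomorphisms from `A₁` and `A₂` to a unital
C⋆-algebra. -/
def freeNorm : CStarSeminorm (FreeStarAlgebra A₁ A₂) :=
  CStarSeminorm.ofFamily (fun f : HomPair A₁ A₂ => f.eval) HomPair.bddAbove_eval

theorem le_freeNorm (f : HomPair A₁ A₂) (x : FreeStarAlgebra A₁ A₂) :
    ‖f.eval x‖ ≤ (freeNorm A₁ A₂).toSeminorm x :=
  le_ciSup (f := fun f : HomPair A₁ A₂ => ‖f.eval x‖) (HomPair.bddAbove_eval x) f

variable (A₁ A₂) in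
/-- The (full) free product of two unital C⋆-algebras, with the units identified: the
separation-completion of the free ⋆-algebra generated by the elements of `A₁` and `A₂` in the
largest C⋆-seminorm which respects the algebraic relations of `A₁` and of `A₂`. -/
abbrev FreeProduct : Type u := (freeNorm A₁ A₂).Completion

namespace FreeProduct

theorem of_eq_of {x y : FreeStarAlgebra A₁ A₂} (h : ∀ f : HomPair A₁ A₂, f.eval x = f.eval y) :
    (freeNorm A₁ A₂).of x = (freeNorm A₁ A₂).of y := by
  rw [← sub_eq_zero, ← map_sub, ← norm_le_zero_iff, CStarSeminorm.norm_of]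
  exact Real.iSup_le (fun f => by rw [map_sub, h, sub_self, norm_zero]) le_rfl

variable (A₁ A₂) in
/-- The canonical inclusion of the first factor. -/
def inl : A₁ →⋆ₐ[ℂ] FreeProduct A₁ A₂ where
  toFun a := (freeNorm A₁ A₂).of (FreeStarAlgebra.gen (Sum.inl a))
  map_one' := by
    rw [← map_one (freeNorm A₁ A₂).of]
    exact of_eq_of fun f => by rw [HomPair.eval_gen, map_one]; exact map_one f.fst
  map_zero' := by
    rw [← map_zero (freeNorm A₁ A₂).of]
    exact of_eq_of fun f => by rw [HomPair.eval_gen, map_zero]; exact map_zero f.fst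
  map_mul' a b := by
    rw [← map_mul]
    exact of_eq_of fun f => by
      rw [map_mul, HomPair.eval_gen, HomPair.eval_gen, HomPair.eval_gen]; exact map_mul f.fst a b
  map_add' a b := by
    rw [← map_add]
    exact of_eq_of fun f => by
      rw [map_add, HomPair.eval_gen, HomPair.eval_gen, HomPair.eval_gen]; exact map_add f.fst a b
  commutes' c := by
    rw [← AlgHomClass.commutes (freeNorm A₁ A₂).of]
    exact of_eq_of fun f => by
      rw [AlgHomClass.commutes, HomPair.eval_gen]; exact AlgHomClass.commutes f.fst c
  map_star' a := by
    rw [← map_star]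
    exact of_eq_of fun f => by
      rw [map_star, HomPair.eval_gen, HomPair.eval_gen]; exact map_star f.fst a

variable (A₁ A₂) in
/-- The canonical inclusion of the second factor. -/
def inr : A₂ →⋆ₐ[ℂ] FreeProduct A₁ A₂ where
  toFun a := (freeNorm A₁ A₂).of (FreeStarAlgebra.gen (Sum.inr a))
  map_one' := by
    rw [← map_one (freeNorm A₁ A₂).of]
    exact of_eq_of fun f => by rw [HomPair.eval_gen, map_one]; exact map_one f.snd
  map_zero' := by
    rw [← map_zero (freeNorm A₁ A₂).of]
    exact of_eq_of fun f => by rw [HomPair.eval_gen, map_zero]; exact map_zero f.snd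
  map_mul' a b := by
    rw [← map_mul]
    exact of_eq_of fun f => by
      rw [map_mul, HomPair.eval_gen, HomPair.eval_gen, HomPair.eval_gen]; exact map_mul f.snd a b
  map_add' a b := by
    rw [← map_add]
    exact of_eq_of fun f => by
      rw [map_add, HomPair.eval_gen, HomPair.eval_gen, HomPair.eval_gen]; exact map_add f.snd a b
  commutes' c := by
    rw [← AlgHomClass.commutes (freeNorm A₁ A₂).of]
    exact of_eq_of fun f => by
      rw [AlgHomClass.commutes, HomPair.eval_gen]; exact AlgHomClass.commutes f.snd c
  map_star' a := by
    rw [← map_star]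
    exact of_eq_of fun f => by
      rw [map_star, HomPair.eval_gen, HomPair.eval_gen]; exact map_star f.snd a

end FreeProduct

end FreeProduct

/-! ### Compact quantum semigroups -/

section QuantumSemigroup

variable {A C : Type u} [CStarAlgebra A] [CStarAlgebra C]

/-- Coassociativity `(Δ ⊗ id) ∘ Δ = (id ⊗ Δ) ∘ Δ`, up to the identification of `(A ⊗ A) ⊗ A` with
`A ⊗ (A ⊗ A)`. A unital C⋆-algebra with a coassociative unital ⋆-homomorphism `Δ : A → A ⊗ A` is
a compact quantum semigroup. -/
def IsCoassociative (Δ : A →⋆ₐ[ℂ] MinTensor A A) : Prop :=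
  (MinTensor.assoc A A A).comp ((MinTensor.map Δ (StarAlgHom.id ℂ A)).comp Δ)
    = (MinTensor.map (StarAlgHom.id ℂ A) Δ).comp Δ

/-- A unital ⋆-homomorphism `Θ : A → C` is a quantum semigroup morphism with respect to the
comultiplications `ΔA` and `ΔC` if `(Θ ⊗ Θ) ∘ ΔA = ΔC ∘ Θ`. -/
def IsQuantumSemigroupMorphism (ΔA : A →⋆ₐ[ℂ] MinTensor A A) (ΔC : C →⋆ₐ[ℂ] MinTensor C C)
    (Θ : A →⋆ₐ[ℂ] C) : Prop :=
  (MinTensor.map Θ Θ).comp ΔA = ΔC.comp Θ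

end QuantumSemigroup

end

/-! The free product $C$ is the coproduct of $A_1$ and $A_2$ among unital C⋆-algebras: a pair of
⋆-homomorphisms on the factors extends to $C$ (`FreeProduct.desc`), and a ⋆-homomorphism on $C$ is
determined by its restrictions to the factors (`FreeProduct.hom_ext`). The requirement that
$\iota_k$ be a morphism reads $\Delta_C\circ\iota_k=(\iota_k\otimes\iota_k)\circ\Delta_k$. It
prescribes $\Delta_C$ on both factors, so exactly one ⋆-homomorphism $\Delta_C$ satisfies it.

Every other identity in the theorem is an equality of two ⋆-homomorphisms out of $C$ and need only
be tested after composition with $\iota_1$ and $\iota_2$. For coassociativity, this test is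
`IsCoassociative.comp_eq`: both triple comultiplications composed with $\iota_k$ are images, under
triple tensor powers of $\iota_k$, of the corresponding maps for $\Delta_k$, and those agree up to
the associator. For the compatibility of $\Theta_C$ with the comultiplications, it is
`IsQuantumSemigroupMorphism.comp_eq`.

The analysis lies in the existence of `MinTensor.map` and `MinTensor.assoc` as ⋆-homomorphisms of
completed tensor products. The argument from here on is formal: functoriality of the tensor product
(`MinTensor.map_comp_map`) and naturality of the associator (`MinTensor.assoc_comp_map_map`), both
tested on elementary tensors. Injectivity of $\iota_k$ plays no role. -/

/-! ### Functoriality of the minimal tensor product and naturality of the associator. -/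

namespace MinTensor

variable {A B D A' B' D' A'' B'' : Type u} [CStarAlgebra A] [CStarAlgebra B] [CStarAlgebra D]
  [CStarAlgebra A'] [CStarAlgebra B'] [CStarAlgebra D'] [CStarAlgebra A''] [CStarAlgebra B'']

/-- Serves to move a relation that holds in one tensor leg, such as the morphism identity for
$\iota$, through a product map whose other leg carries an identity or $\iota$. -/
theorem map_comp_map (f' : A' →⋆ₐ[ℂ] A'') (g' : B' →⋆ₐ[ℂ] B'') (f : A →⋆ₐ[ℂ] A')
    (g : B →⋆ₐ[ℂ] B') : (map f' g').comp (map f g) = map (f'.comp f) (g'.comp g) :=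
  hom_ext fun a b => by simp only [StarAlgHom.comp_apply, map_tmul]

/-- The left leg is itself a completion, so `hom_ext` alone leaves $z\otimes d$ with $z$ an
arbitrary element of $A\otimes B$, possibly not a sum of elementary tensors. The factorisation
$z\otimes d=(z\otimes1)(1\otimes d)$ separates the legs, and `hom_ext` applies once more to the
restriction $z\mapsto f(z\otimes1)$. -/
theorem hom_ext₃ {E : Type*} [CStarAlgebra E] {f g : MinTensor (MinTensor A B) D →⋆ₐ[ℂ] E}
    (h : ∀ a b d, f (tmul (tmul a b) d) = g (tmul (tmul a b) d)) : f = g := by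
  have hl : f.comp (inlHom (MinTensor A B) D) = g.comp (inlHom (MinTensor A B) D) :=
    hom_ext fun a b => h a b 1
  -- The unit of $A\otimes B$ is by definition the elementary tensor $1\otimes1$, so $1\otimes d$ is
  -- already of the form covered by `h`.
  have hr (d : D) : f (inrHom (MinTensor A B) D d) = g (inrHom (MinTensor A B) D d) := h 1 1 d
  refine hom_ext fun z d => ?_
  rw [← inl_mul_inr, map_mul, map_mul, hr]
  exact congrArg (· * _) (DFunLike.congr_fun hl z)

/-- Naturality of the associator. -/
theorem assoc_comp_map_map (f : A →⋆ₐ[ℂ] A') (g : B →⋆ₐ[ℂ] B') (h : D →⋆ₐ[ℂ] D') :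
    (assoc A' B' D').comp (map (map f g) h) = (map f (map g h)).comp (assoc A B D) :=
  hom_ext₃ fun a b d => by simp only [StarAlgHom.comp_apply, map_tmul, assoc_tmul]

end MinTensor

/-! ### Universal property of the free product. -/

namespace FreeProduct

variable {A₁ A₂ : Type u} [CStarAlgebra A₁] [CStarAlgebra A₂]

/-- The uniqueness half of the universal property. ⋆-homomorphisms of C⋆-algebras are continuous and
the image of the free ⋆-algebra is dense, so agreement may be checked on words in the generators,
which come from the two factors. -/
theorem hom_ext {E : Type*} [CStarAlgebra E] {f g : FreeProduct A₁ A₂ →⋆ₐ[ℂ] E}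
    (hl : f.comp (inl A₁ A₂) = g.comp (inl A₁ A₂))
    (hr : f.comp (inr A₁ A₂) = g.comp (inr A₁ A₂)) : f = g := by
  refine (freeNorm A₁ A₂).hom_ext fun x => ?_
  -- No case for the involution arises: the adjoint of a generator is again a generator, so sums and
  -- products of generators and scalars exhaust the free ⋆-algebra.
  refine FreeStarAlgebra.induction
    (P := fun x => f ((freeNorm A₁ A₂).of x) = g ((freeNorm A₁ A₂).of x)) ?_ ?_ ?_ ?_ x
  · intro c
    simp only [AlgHomClass.commutes]
  · rintro (a | a)
    · exact DFunLike.congr_fun hl a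
    · exact DFunLike.congr_fun hr a
  · intro x y hx hy
    simp only [map_mul, hx, hy]
  · intro x y hx hy
    simp only [map_add, hx, hy]

/-- The ⋆-homomorphism on the free product which is given by `f` and `g` on the factors. -/
noncomputable def desc {E : Type u} [CStarAlgebra E] (f : A₁ →⋆ₐ[ℂ] E) (g : A₂ →⋆ₐ[ℂ] E) :
    FreeProduct A₁ A₂ →⋆ₐ[ℂ] E :=
  -- The pair $(f,g)$ is itself a member of the family whose supremum defines `freeNorm`, which
  -- gives the domination needed to extend to the completion. That family ranges over targets in
  -- `Type u`, hence the universe of `E`.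
  (freeNorm A₁ A₂).lift (HomPair.mk E f g).eval (le_freeNorm (HomPair.mk E f g))

/-- Together with `desc_comp_inr`, the existence half of the universal property: the image of $a$ in
the free product is the class of a single generator, where the extension takes the prescribed value.
-/
theorem desc_comp_inl {E : Type u} [CStarAlgebra E] (f : A₁ →⋆ₐ[ℂ] E) (g : A₂ →⋆ₐ[ℂ] E) :
    (desc f g).comp (inl A₁ A₂) = f :=
  StarAlgHom.ext fun a => ((freeNorm A₁ A₂).lift_of _ (le_freeNorm (HomPair.mk E f g)) _).trans
    ((HomPair.mk E f g).eval_gen (Sum.inl a))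

theorem desc_comp_inr {E : Type u} [CStarAlgebra E] (f : A₁ →⋆ₐ[ℂ] E) (g : A₂ →⋆ₐ[ℂ] E) :
    (desc f g).comp (inr A₁ A₂) = g :=
  StarAlgHom.ext fun a => ((freeNorm A₁ A₂).lift_of _ (le_freeNorm (HomPair.mk E f g)) _).trans
    ((HomPair.mk E f g).eval_gen (Sum.inr a))

end FreeProduct

/-! ### Transport of coassociativity and of the morphism property along $\iota$. -/

section QuantumSemigroup

variable {A C D : Type u} [CStarAlgebra A] [CStarAlgebra C] [CStarAlgebra D]

/-- A comultiplication is coassociative on the range of a morphism from a compact quantum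
semigroup. -/
theorem IsCoassociative.comp_eq {ΔA : A →⋆ₐ[ℂ] MinTensor A A} {ΔC : C →⋆ₐ[ℂ] MinTensor C C}
    {ι : A →⋆ₐ[ℂ] C} (hA : IsCoassociative ΔA) (hι : IsQuantumSemigroupMorphism ΔA ΔC ι) :
    ((MinTensor.assoc C C C).comp ((MinTensor.map ΔC (StarAlgHom.id ℂ C)).comp ΔC)).comp ι
      = ((MinTensor.map (StarAlgHom.id ℂ C) ΔC).comp ΔC).comp ι := by
  unfold IsCoassociative at hA
  unfold IsQuantumSemigroupMorphism at hι
  -- Both sides equal $(\Delta_C\circ\iota)\otimes\iota$: on the right, the first leg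
  -- $(\iota\otimes\iota)\circ\Delta_A$ becomes $\Delta_C\circ\iota$ by the morphism identity.
  have hl : (MinTensor.map ΔC (StarAlgHom.id ℂ C)).comp (MinTensor.map ι ι)
      = (MinTensor.map (MinTensor.map ι ι) ι).comp (MinTensor.map ΔA (StarAlgHom.id ℂ A)) := by
    rw [MinTensor.map_comp_map, MinTensor.map_comp_map, hι, StarAlgHom.id_comp,
      StarAlgHom.comp_id]
  -- The mirror image of `hl`, with common value $\iota\otimes(\Delta_C\circ\iota)$.
  have hr : (MinTensor.map (StarAlgHom.id ℂ C) ΔC).comp (MinTensor.map ι ι)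
      = (MinTensor.map ι (MinTensor.map ι ι)).comp (MinTensor.map (StarAlgHom.id ℂ A) ΔA) := by
    rw [MinTensor.map_comp_map, MinTensor.map_comp_map, hι, StarAlgHom.id_comp,
      StarAlgHom.comp_id]
  -- The chain pushes $\iota$ outwards until only $\Delta_A$ is iterated, applies coassociativity
  -- over $A$, and pulls $\iota$ back in on the other side.
  calc ((MinTensor.assoc C C C).comp ((MinTensor.map ΔC (StarAlgHom.id ℂ C)).comp ΔC)).comp ι
      = (MinTensor.assoc C C C).comp
          (((MinTensor.map ΔC (StarAlgHom.id ℂ C)).comp (MinTensor.map ι ι)).comp ΔA) := by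
        rw [StarAlgHom.comp_assoc, StarAlgHom.comp_assoc, ← hι, StarAlgHom.comp_assoc]
    _ = ((MinTensor.assoc C C C).comp (MinTensor.map (MinTensor.map ι ι) ι)).comp
          ((MinTensor.map ΔA (StarAlgHom.id ℂ A)).comp ΔA) := by
        rw [hl]; simp only [StarAlgHom.comp_assoc]
    _ = (MinTensor.map ι (MinTensor.map ι ι)).comp
          ((MinTensor.map (StarAlgHom.id ℂ A) ΔA).comp ΔA) := by
        -- Naturality replaces the associator of $C$ by that of $A$, which is the one occurring in
        -- the coassociativity of $\Delta_A$.
        rw [MinTensor.assoc_comp_map_map, StarAlgHom.comp_assoc, hA]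
    _ = ((MinTensor.map (StarAlgHom.id ℂ C) ΔC).comp ΔC).comp ι := by
        rw [← StarAlgHom.comp_assoc, ← hr, StarAlgHom.comp_assoc, hι, StarAlgHom.comp_assoc]

/-- If `Θ ∘ ι` and `ι` are morphisms, then `Θ` is compatible with the comultiplications on the
range of `ι`. -/
theorem IsQuantumSemigroupMorphism.comp_eq {ΔA : A →⋆ₐ[ℂ] MinTensor A A}
    {ΔC : C →⋆ₐ[ℂ] MinTensor C C} {ΔD : D →⋆ₐ[ℂ] MinTensor D D} {ι : A →⋆ₐ[ℂ] C} {Θ : C →⋆ₐ[ℂ] D}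
    (hι : IsQuantumSemigroupMorphism ΔA ΔC ι)
    (hΘ : IsQuantumSemigroupMorphism ΔA ΔD (Θ.comp ι)) :
    ((MinTensor.map Θ Θ).comp ΔC).comp ι = (ΔD.comp Θ).comp ι := by
  unfold IsQuantumSemigroupMorphism at hι hΘ
  -- In formulas:
  -- $(\Theta\otimes\Theta)\Delta_C\iota=(\Theta\otimes\Theta)(\iota\otimes\iota)\Delta_A=(\Theta\iota\otimes\Theta\iota)\Delta_A=\Delta_D\Theta\iota$.
  rw [StarAlgHom.comp_assoc, ← hι, ← StarAlgHom.comp_assoc, MinTensor.map_comp_map, hΘ,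
    StarAlgHom.comp_assoc]

end QuantumSemigroup

/-! ### The comultiplication on the free product and its universal property. -/

theorem theorem3p1 {A₁ A₂ : Type u} [CStarAlgebra A₁] [CStarAlgebra A₂]
    (Δ₁ : A₁ →⋆ₐ[ℂ] MinTensor A₁ A₁) (Δ₂ : A₂ →⋆ₐ[ℂ] MinTensor A₂ A₂)
    (h₁ : IsCoassociative Δ₁) (h₂ : IsCoassociative Δ₂) :
    ∃ ΔC : FreeProduct A₁ A₂ →⋆ₐ[ℂ] MinTensor (FreeProduct A₁ A₂) (FreeProduct A₁ A₂),
      (IsCoassociative ΔC ∧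
        IsQuantumSemigroupMorphism Δ₁ ΔC (FreeProduct.inl A₁ A₂) ∧
        IsQuantumSemigroupMorphism Δ₂ ΔC (FreeProduct.inr A₁ A₂)) ∧
      (∀ Δ' : FreeProduct A₁ A₂ →⋆ₐ[ℂ] MinTensor (FreeProduct A₁ A₂) (FreeProduct A₁ A₂),
        IsCoassociative Δ' →
        IsQuantumSemigroupMorphism Δ₁ Δ' (FreeProduct.inl A₁ A₂) →
        IsQuantumSemigroupMorphism Δ₂ Δ' (FreeProduct.inr A₁ A₂) → Δ' = ΔC) ∧
      ∀ (D : Type u) [CStarAlgebra D] (ΔD : D →⋆ₐ[ℂ] MinTensor D D)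
        (Θ₁ : A₁ →⋆ₐ[ℂ] D) (Θ₂ : A₂ →⋆ₐ[ℂ] D), IsCoassociative ΔD →
        IsQuantumSemigroupMorphism Δ₁ ΔD Θ₁ → IsQuantumSemigroupMorphism Δ₂ ΔD Θ₂ →
        ∃! ΘC : FreeProduct A₁ A₂ →⋆ₐ[ℂ] D,
          ΘC.comp (FreeProduct.inl A₁ A₂) = Θ₁ ∧ ΘC.comp (FreeProduct.inr A₁ A₂) = Θ₂ ∧
          IsQuantumSemigroupMorphism ΔC ΔD ΘC := by
  -- The only possible choice: its two components are the values of $\Delta_C\circ\iota_k$ dictated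
  -- by the morphism identities, which therefore hold by the defining property of `desc`.
  let ΔC : FreeProduct A₁ A₂ →⋆ₐ[ℂ] MinTensor (FreeProduct A₁ A₂) (FreeProduct A₁ A₂) :=
    FreeProduct.desc
      ((MinTensor.map (FreeProduct.inl A₁ A₂) (FreeProduct.inl A₁ A₂)).comp Δ₁)
      ((MinTensor.map (FreeProduct.inr A₁ A₂) (FreeProduct.inr A₁ A₂)).comp Δ₂)
  have hl : IsQuantumSemigroupMorphism Δ₁ ΔC (FreeProduct.inl A₁ A₂) :=
    (FreeProduct.desc_comp_inl _ _).symm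
  have hr : IsQuantumSemigroupMorphism Δ₂ ΔC (FreeProduct.inr A₁ A₂) :=
    (FreeProduct.desc_comp_inr _ _).symm
  refine ⟨ΔC, ⟨FreeProduct.hom_ext (h₁.comp_eq hl) (h₂.comp_eq hr), hl, hr⟩, ?_, ?_⟩
  · intro Δ' _ hl' hr'
    -- On the $k$-th factor both comultiplications equal $(\iota_k\otimes\iota_k)\circ\Delta_k$.
    exact FreeProduct.hom_ext (hl'.symm.trans hl) (hr'.symm.trans hr)
  · intro D _ ΔD Θ₁ Θ₂ _ hΘ₁ hΘ₂
    have hil := FreeProduct.desc_comp_inl Θ₁ Θ₂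
    have hir := FreeProduct.desc_comp_inr Θ₁ Θ₂
    -- As $\Theta_C\circ\iota_k=\Theta_k$ is a morphism by assumption and $\iota_k$ is one by
    -- construction, the two sides of the identity for $\Theta_C$ agree on each factor.
    refine ⟨FreeProduct.desc Θ₁ Θ₂, ⟨hil, hir, FreeProduct.hom_ext
      (hl.comp_eq (by rwa [hil])) (hr.comp_eq (by rwa [hir]))⟩, ?_⟩
    rintro Θ ⟨h, h', _⟩
    -- The two factorisations through $\iota_1$ and $\iota_2$ already determine the map on $C$.
    exact FreeProduct.hom_ext (h.trans hil.symm) (h'.trans hir.symm)
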